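/- Let $\sigma_0<1$ be real and, for $\sigma\in\mathbb R$, put $\Pi_{\sigma}=\{s\in\mathbb C:\operatorname{Re}(s)>\sigma\}$. Let $L(s)=\sum_{n\ge 1}a_n n^{-s}$ be a Dirichlet series with complex coefficients such that (a) for every $\varepsilon>0$, $a_n=O_\varepsilon(n^{\varepsilon})$ (so the series converges absolutely for $\operatorname{Re}(s)>1$); (b) $L$ has a meromorphic continuation, again denoted by $L$, to $\Pi_{\sigma_0}$, which is analytic except possibly for a pole at $s=1$; let $m_L\ge 0$ be the order of this pole, with $m_L=0$ if $L$ is analytic at $1$; (c) $s\mapsto (s-1)^{m_L}L(s)$ is of finite order in $\Pi_{\sigma_0}$, that is, there is a real $A$ such that $(s-1)^{m_L}L(s)=O(e^{|s|^{A}})$ as $|s|\to\infty$ in $\Pi_{\sigma_0}$. Let $\varphi:[0,\infty)\to\mathbb C$ be Lebesgue measurable, zero on $(1,\infty)$ and locally bounded on $(0,1)$, with $\varphi(x)=O(x^{-\sigma_0})$ as $x\to0^+$ and $\varphi(x)=O((1-x)^{-\sigma_1})$ as $x\to1^-$ for some $\sigma_1<\tfrac12$. Let $\hat\varphi(s)=\int_0^{\infty}\varphi(t)\,t^{s-1}\,dt$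 be its Mellin transform (the integral converges absolutely for $s\in\Pi_{\sigma_0}$), and put $$\psi(u)=\operatorname{Res}\bigl(L(s)\hat\varphi(s)u^{s},\,s=1\bigr)-\sum_{1\le n<u}a_n\,\varphi\!\left(\frac nu\right)\qquad(u>0).$$ Let $r>\sigma_0$ be real, and assume $r\ne 1$ if $m_L\ge 1$. Then the following are equivalent: (i) $\psi$ belongs to $L^2\bigl((1,\infty),\frac{du}{u^{1+2r}}\bigr)$; (ii) the function $t\mapsto L(r+it)\,\hat\varphi(r+it)$ belongs to $L^2(\mathbb R)$. -/

import Mathlib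

open Complex Set Filter Topology MeasureTheory Asymptotics

namespace DirichletMellin

/-- The open half-plane `Π_σ = {s : Re s > σ}`. -/
def halfPlane (σ : ℝ) : Set ℂ := {s | σ < s.re}

/-- The order of the pole of `f` at `z₀`, for `f` meromorphic at `z₀`; it is `0` if and only if
`f` has no pole at `z₀` (this includes functions vanishing identically near `z₀`). -/
noncomputable def poleOrder (f : ℂ → ℂ) (z₀ : ℂ) : ℕ :=
  (-(meromorphicOrderAt f z₀).untop₀).toNat

/-- The residue of `f` at `z₀`: the value of `(2πi)⁻¹ ∮ f` over circles of small radius centred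
at `z₀`. (At an isolated singularity that value does not depend on the small radius.) -/
noncomputable def residue (f : ℂ → ℂ) (z₀ : ℂ) : ℂ :=
  limUnder (𝓝[>] (0 : ℝ)) fun R : ℝ => (2 * Real.pi * I : ℂ)⁻¹ * ∮ z in C(z₀, R), f z

/-- `f` has finite order in `U`: `f(s) = O(exp(|s| ^ A))` as `|s| → ∞` in `U`, for some `A`. -/
def HasFiniteOrderOn (f : ℂ → ℂ) (U : Set ℂ) : Prop :=
  ∃ A : ℝ, f =O[Bornology.cobounded ℂ ⊓ 𝓟 U] fun s => Real.exp (‖s‖ ^ A)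

/-- `L` is the meromorphic continuation to `Re s > σ₀` of the Dirichlet series `∑_{n ≥ 1} a n / n ^ s`
(the value `a 0` plays no role), and satisfies the standing assumptions. -/
structure IsContinuedDirichletSeries (a : ℕ → ℂ) (σ₀ : ℝ) (L : ℂ → ℂ) : Prop where
  coeff_isBigO : ∀ ε : ℝ, 0 < ε → a =O[atTop] fun n : ℕ => (n : ℝ) ^ ε
  lt_one : σ₀ < 1
  eq_LSeries : ∀ s : ℂ, 1 < s.re → L s = LSeries a s
  analyticAt_of_ne : ∀ s ∈ halfPlane σ₀, s ≠ 1 → AnalyticAt ℂ L s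
  meromorphicAt_one : MeromorphicAt L 1
  analyticAt_one : poleOrder L 1 = 0 → AnalyticAt ℂ L 1
  finiteOrder : HasFiniteOrderOn (fun s => (s - 1) ^ poleOrder L 1 * L s) (halfPlane σ₀)

/-- The standing assumptions on the auxiliary function `φ` on `[0, ∞)`
(the values of `φ` at negative reals play no role). -/
structure IsAuxiliary (φ : ℝ → ℂ) (σ₀ : ℝ) : Prop where
  measurable : AEMeasurable φ (volume.restrict (Ioi 0))
  eq_zero : ∀ x : ℝ, 1 < x → φ x = 0
  locallyBounded : ∀ x ∈ Ioo (0 : ℝ) 1, ∃ C : ℝ, ∀ᶠ y in 𝓝 x, ‖φ y‖ ≤ C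
  isBigO_zero : φ =O[𝓝[>] 0] fun x : ℝ => x ^ (-σ₀)
  isBigO_one : ∃ σ₁ : ℝ, σ₁ < 1 / 2 ∧ φ =O[𝓝[<] 1] fun x : ℝ => (1 - x) ^ (-σ₁)

/-- `ψ(u) = Res (L(s) φ̂(s) u ^ s, s = 1) - ∑_{1 ≤ n < u} a n φ(n / u)`, where `φ̂` is the Mellin
transform of `φ`. The index set is right since `n < ⌈u⌉₊ ↔ (n : ℝ) < u`. -/
noncomputable def psi (a : ℕ → ℂ) (L : ℂ → ℂ) (φ : ℝ → ℂ) (u : ℝ) : ℂ :=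
  residue (fun s => L s * mellin φ s * (u : ℂ) ^ s) 1
    - ∑ n ∈ Finset.Ico 1 ⌈u⌉₊, a n * φ ((n : ℝ) / u)

/-- The measure `du / u ^ (1 + 2r)` on `(1, ∞)`. -/
noncomputable def weightedMeasure (r : ℝ) : Measure ℝ :=
  (volume.restrict (Ioi 1)).withDensity fun u => ENNReal.ofReal (1 / u ^ (1 + 2 * r))

end DirichletMellin

/-! After the substitution u = exp x, condition (i) says that ψ(exp x) exp(-r x) is square
integrable on x > 0, so the theorem is of Paley–Wiener type for a Laplace transform. For Re s > 1
the sum over n < u is an absolutely convergent series of translates by log n and has transform L(s)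
φ̂(s). The residue is exp x times a polynomial in x, and its transform is the principal part of L φ̂
at 1. Hence ψ(exp x) has transform -G, where G is the holomorphic part of L φ̂ (`laplace_expPsi`).
On Re s = r the principal part is square integrable, because that line avoids the pole, so (ii) is
the same as square integrability of G there (`memLp_mul_mellin_iff`).

(i) ⇒ (ii), `memLp_boundary_of_memLp`: the transform converges for Re s > r and equals -G there by
the identity theorem. Plancherel bounds it uniformly on the lines Re s = c > r, and Fatou's lemma
gives the line Re s = r.

(ii) ⇒ (i), `memLp_of_memLp_boundary`: Plancherel is available only on a line Re s = b > 1. Truncate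
g to x ≤ X, and let W be 2π times the squared norm of the truncation weighted by exp(-r x). Parseval
on Re s = b writes W as the modulus of the integral of G E, where E is an entire function built from
the transform of the truncation. Moving the line to Re s = r, where E has squared norm W, gives W ≤
(‖G‖² + W) / 2, that is W ≤ ‖G‖², uniformly in X.

The move is `integral_vertical_eq`: integrability on the two edges and a Phragmén–Lindelöf growth
condition suffice, with no decay assumed on horizontal segments. The finite order of L supplies the
growth condition. -/

namespace DirichletMellin
-- Plancherel for integrable, square integrable functions and for Laplace transforms on vertical
-- lines
open FourierTransform SchwartzMap in
-- Pair both sides with a test function. On the left the transform passes to the test function by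
-- the definition of the distributional Fourier transform, on the right by Fubini. This turns the
-- abstract L² isometry into a statement about Fourier integrals.
theorem fourier_toLp_ae_eq {f : ℝ → ℂ} (h1 : Integrable f) (h2 : MemLp f 2) :
    (𝓕 (h2.toLp f) : Lp ℂ 2 (volume : Measure ℝ)) =ᵐ[volume] 𝓕 f := by
  have hc : Continuous (𝓕 f) :=
    VectorFourier.fourierIntegral_continuous Real.continuous_fourierChar
      (by exact continuous_inner) h1
  refine ae_eq_of_integral_contDiff_smul_eq
    ((Lp.memLp _).locallyIntegrable (by norm_num)) hc.locallyIntegrable fun g hg hgc => ?_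
  have hg' : ContDiff ℝ ((⊤ : ℕ∞) : WithTop ℕ∞) (fun x => (g x : ℂ)) := ofRealCLM.contDiff.comp hg
  have hgc' : HasCompactSupport (fun x => (g x : ℂ)) := hgc.comp_left (g := ofReal) rfl
  set G : 𝓢(ℝ, ℂ) := hgc'.toSchwartzMap hg'
  have hG : ∀ x, G x = (g x : ℂ) := fun x => rfl
  have e1 : Lp.toTemperedDistribution (𝓕 (h2.toLp f)) G
      = ∫ x, G x • (𝓕 (h2.toLp f) : Lp ℂ 2 (volume : Measure ℝ)) x :=
    Lp.toTemperedDistribution_apply _ _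
  rw [← Lp.fourier_toTemperedDistribution_eq, TemperedDistribution.fourier_apply,
    Lp.toTemperedDistribution_apply] at e1
  have e2 : ∫ x, (𝓕 G : 𝓢(ℝ, ℂ)) x • (h2.toLp f) x = ∫ x, 𝓕 (G : ℝ → ℂ) x • f x := by
    refine integral_congr_ae ?_
    filter_upwards [h2.coeFn_toLp] with x hx
    rw [hx, fourier_coe]
  have e3 : ∫ x, 𝓕 (G : ℝ → ℂ) x • f x = ∫ x, G x • 𝓕 f x := by
    have := VectorFourier.integral_fourierIntegral_smul_eq_flip (L := innerₗ ℝ)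
      Real.continuous_fourierChar (by exact continuous_inner) (G.integrable (μ := volume)) h1
    rw [flip_innerₗ] at this
    exact this
  have : ∀ (u : ℝ → ℂ), ∫ x, g x • u x = ∫ x, G x • u x := fun u => by simp [hG]
  rw [this, this, ← e1, e2, e3]

open FourierTransform in
theorem memLp_fourier {f : ℝ → ℂ} (h1 : Integrable f) (h2 : MemLp f 2) : MemLp (𝓕 f) 2 :=
  (memLp_congr_ae (fourier_toLp_ae_eq h1 h2)).1 (Lp.memLp _)

open FourierTransform ComplexConjugate in
theorem integral_conj_fourier_mul_fourier {f g : ℝ → ℂ} (hf1 : Integrable f) (hf2 : MemLp f 2)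
    (hg1 : Integrable g) (hg2 : MemLp g 2) :
    ∫ t, conj (𝓕 f t) * 𝓕 g t = ∫ x, conj (f x) * g x := by
  have := Lp.inner_fourier_eq (hf2.toLp f) (hg2.toLp g)
  rw [L2.inner_def, L2.inner_def] at this
  convert! this using 1
  · refine integral_congr_ae ?_
    filter_upwards [fourier_toLp_ae_eq hf1 hf2, fourier_toLp_ae_eq hg1 hg2] with x hx hy
    simp [hx, hy, mul_comm]
  · refine integral_congr_ae ?_
    filter_upwards [hf2.coeFn_toLp, hg2.coeFn_toLp] with x hx hy
    simp [hx, hy, mul_comm]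

/-- The two-sided Laplace transform. -/
noncomputable def laplace (g : ℝ → ℂ) (s : ℂ) : ℂ := ∫ x : ℝ, g x * exp (-(s * x))

open FourierTransform in
theorem laplace_eq_fourier (g : ℝ → ℂ) (c t : ℝ) :
    laplace g (c + t * I) = 𝓕 (fun x : ℝ => g x * exp (-(c * x : ℂ))) (t / (2 * Real.pi)) := by
  rw [laplace, Real.fourier_eq']
  refine integral_congr_ae (Eventually.of_forall fun x => ?_)
  simp only [smul_eq_mul]
  rw [mul_comm (cexp _), mul_assoc, ← exp_add]
  congr 2
  have : (Real.pi : ℂ) ≠ 0 := by exact_mod_cast Real.pi_ne_zero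
  simp
  field_simp
  ring

theorem memLp_laplace {g : ℝ → ℂ} {c : ℝ} (h1 : Integrable fun x : ℝ => g x * exp (-(c * x : ℂ)))
    (h2 : MemLp (fun x : ℝ => g x * exp (-(c * x : ℂ))) 2) :
    MemLp (fun t : ℝ => laplace g (c + t * I)) 2 := by
  simp_rw [laplace_eq_fourier, div_eq_mul_inv]
  have hpi : (2 * Real.pi)⁻¹ ≠ 0 := by positivity
  have h := memLp_fourier h1 h2
  rw [memLp_two_iff_integrable_sq_norm h.1] at h
  have hq : Measure.QuasiMeasurePreserving (fun t : ℝ => t * (2 * Real.pi)⁻¹) :=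
    ⟨by fun_prop, by
      rw [Real.map_volume_mul_right hpi]
      exact Measure.smul_absolutelyContinuous⟩
  rw [memLp_two_iff_integrable_sq_norm]
  · exact h.comp_mul_right' hpi
  · exact (memLp_fourier h1 h2).1.comp_quasiMeasurePreserving hq

open ComplexConjugate in
theorem integral_conj_laplace_mul_laplace {g h : ℝ → ℂ} {c : ℝ}
    (g1 : Integrable fun x : ℝ => g x * exp (-(c * x : ℂ)))
    (g2 : MemLp (fun x : ℝ => g x * exp (-(c * x : ℂ))) 2)
    (h1 : Integrable fun x : ℝ => h x * exp (-(c * x : ℂ)))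
    (h2 : MemLp (fun x : ℝ => h x * exp (-(c * x : ℂ))) 2) :
    ∫ t : ℝ, conj (laplace g (c + t * I)) * laplace h (c + t * I)
      = 2 * Real.pi * ∫ x : ℝ, conj (g x * exp (-(c * x : ℂ))) * (h x * exp (-(c * x : ℂ))) := by
  rw [← integral_conj_fourier_mul_fourier g1 g2 h1 h2]
  simp_rw [laplace_eq_fourier, div_eq_mul_inv]
  rw [Measure.integral_comp_mul_right (fun t => conj
    ((FourierTransform.fourier fun x : ℝ => g x * exp (-(c * x : ℂ))) t) *
    ((FourierTransform.fourier fun x : ℝ => h x * exp (-(c * x : ℂ))) t))]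
  rw [inv_inv, abs_of_pos (by positivity), real_smul]
  push_cast
  rfl

theorem integral_norm_sq_laplace {g : ℝ → ℂ} {c : ℝ}
    (g1 : Integrable fun x : ℝ => g x * exp (-(c * x : ℂ)))
    (g2 : MemLp (fun x : ℝ => g x * exp (-(c * x : ℂ))) 2) :
    ∫ t : ℝ, ‖laplace g (c + t * I)‖ ^ 2
      = 2 * Real.pi * ∫ x : ℝ, ‖g x * exp (-(c * x : ℂ))‖ ^ 2 := by
  have h := integral_conj_laplace_mul_laplace g1 g2 g1 g2
  simp_rw [conj_mul'] at h
  norm_cast at h ⊢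
end DirichletMellin

/-! ### Moving the line of integration across a strip -/

namespace DirichletMellin

theorem differentiableAt_integral_vertical {f : ℂ → ℂ} {σ₀ : ℝ}
    (hf : DifferentiableOn ℂ f (halfPlane σ₀)) {h : ℝ → ℂ} (hm : Measurable h)
    (hb : ∀ y, ‖h y‖ ≤ 1) {Y : ℝ} {s₀ : ℂ} (hs : σ₀ < s₀.re) :
    DifferentiableAt ℂ (fun s => ∫ y in Icc (-Y) Y, f (s + y * I) * h y) s₀ := by
  have hopen : IsOpen (halfPlane σ₀) := isOpen_lt continuous_const continuous_re
  have hd : DifferentiableOn ℂ (deriv f) (halfPlane σ₀) := hf.deriv hopen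
  set ε := (s₀.re - σ₀) / 2 with hε
  have hε0 : 0 < ε := by rw [hε]; linarith
  have hmem : ∀ s ∈ Metric.closedBall s₀ ε, ∀ y : ℝ, s + y * I ∈ halfPlane σ₀ := by
    intro s hs y
    have := (abs_re_le_norm (s - s₀)).trans (mem_closedBall_iff_norm.1 hs)
    rw [sub_re, abs_le] at this
    simp only [halfPlane, mem_ofPred_eq, add_re, mul_re, ofReal_re, I_re, ofReal_im, I_im]
    linarith
  obtain ⟨B, hB⟩ : ∃ B, ∀ p ∈ Metric.closedBall s₀ ε ×ˢ Icc (-Y) Y,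
      ‖deriv f (p.1 + (p.2 : ℝ) * I)‖ ≤ B := by
    refine ((isCompact_closedBall s₀ ε).prod isCompact_Icc).exists_bound_of_continuousOn
      (hd.continuousOn.comp (by fun_prop) ?_)
    rintro ⟨s, y⟩ ⟨hs, -⟩
    exact hmem s hs y
  have hcont : ∀ s ∈ Metric.closedBall s₀ ε, Continuous fun y : ℝ => f (s + y * I) := fun s hs =>
    hf.continuousOn.comp_continuous (by fun_prop) (hmem s hs)
  have hmeas : ∀ s ∈ Metric.closedBall s₀ ε, AEStronglyMeasurable (fun y : ℝ => f (s + y * I) * h y)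
      (volume.restrict (Icc (-Y) Y)) := fun s hs =>
    ((hcont s hs).aestronglyMeasurable.mul hm.aestronglyMeasurable)
  have hs₀ : s₀ ∈ Metric.closedBall s₀ ε := Metric.mem_closedBall_self hε0.le
  refine (hasDerivAt_integral_of_dominated_loc_of_deriv_le
    (F := fun s y => f (s + (y : ℝ) * I) * h y)
    (F' := fun s y => deriv f (s + (y : ℝ) * I) * h y) (bound := fun _ => B)
    (Metric.closedBall_mem_nhds s₀ hε0) ?_ ?_ ?_ ?_ ?_ ?_).2.differentiableAt
  · filter_upwards [Metric.closedBall_mem_nhds s₀ hε0] with s hs using hmeas s hs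
  · have h1 : IntegrableOn (fun y : ℝ => f (s₀ + y * I)) (Icc (-Y) Y) :=
      (hcont s₀ hs₀).continuousOn.integrableOn_compact isCompact_Icc
    exact h1.mul_bdd hm.aestronglyMeasurable (Eventually.of_forall hb)
  · exact (hd.continuousOn.comp_continuous (by fun_prop) (hmem s₀ hs₀)).aestronglyMeasurable.mul
      hm.aestronglyMeasurable
  · refine (ae_restrict_iff' measurableSet_Icc).2 (Eventually.of_forall fun y hy s hs => ?_)
    rw [norm_mul]
    have h1 := hB (s, y) ⟨hs, hy⟩
    exact (mul_le_mul h1 (hb y) (norm_nonneg _) ((norm_nonneg _).trans h1)).trans_eq (mul_one _)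
  · exact integrable_const _
  · refine Eventually.of_forall fun y s hs => ?_
    have h1 : HasDerivAt f (deriv f (s + y * I)) (s + y * I) :=
      (hf.differentiableAt (hopen.mem_nhds (hmem s hs y))).hasDerivAt
    exact (h1.comp_add_const s (y * I)).mul_const _

/-- Growth at most doubly exponential in a closed vertical strip. -/
def GrowthBound (f : ℂ → ℂ) (a b c : ℝ) : Prop :=
  ∃ M T : ℝ, ∀ s : ℂ, a ≤ s.re → s.re ≤ b → T ≤ |s.im| →
    ‖f s‖ ≤ M * Real.exp (Real.exp (c * |s.im|))

/-- A window [-Y, Y] with a bounded weight `h` turns an L¹ norm on a line into a function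
holomorphic in `s`. On the edges of the strip it is at most the L¹ norm of `f` there, whatever `Y`
and `h` are, and Phragmén–Lindelöf carries the bound inside. -/
theorem norm_integral_vertical_le {f : ℂ → ℂ} {σ₀ a b c : ℝ}
    (hf : DifferentiableOn ℂ f (halfPlane σ₀)) (ha : σ₀ < a) (hc0 : 0 ≤ c)
    (hc : c < Real.pi / (b - a)) (hg : GrowthBound f a b c)
    (hfa : Integrable fun t : ℝ => f (a + t * I)) (hfb : Integrable fun t : ℝ => f (b + t * I))
    {h : ℝ → ℂ} (hm : Measurable h) (hb : ∀ y, ‖h y‖ ≤ 1) (Y : ℝ) {s : ℂ} (hsa : a ≤ s.re)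
    (hsb : s.re ≤ b) :
    ‖∫ y in Icc (-Y) Y, f (s + y * I) * h y‖
      ≤ max (∫ t : ℝ, ‖f (a + t * I)‖) (∫ t : ℝ, ‖f (b + t * I)‖) := by
  have hedge : ∀ (z : ℂ) (e : ℝ), z.re = e → (Integrable fun t : ℝ => f (e + t * I)) →
      ‖∫ y in Icc (-Y) Y, f (z + y * I) * h y‖ ≤ ∫ t : ℝ, ‖f (e + t * I)‖ := by
    intro z e hz hi
    have hshift : ∀ y : ℝ, z + y * I = e + ((y + z.im : ℝ) : ℂ) * I := fun y => by
      apply Complex.ext <;> simp [hz, add_comm]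
    have hi' : Integrable fun y : ℝ => f (z + y * I) := by
      simp_rw [hshift]
      exact hi.comp_add_right z.im
    calc ‖∫ y in Icc (-Y) Y, f (z + y * I) * h y‖
        ≤ ∫ y in Icc (-Y) Y, ‖f (z + y * I)‖ := by
          refine norm_integral_le_of_norm_le hi'.norm.integrableOn (Eventually.of_forall fun y => ?_)
          rw [norm_mul]
          exact mul_le_of_le_one_right (norm_nonneg _) (hb y)
      _ ≤ ∫ y : ℝ, ‖f (z + y * I)‖ :=
          setIntegral_le_integral hi'.norm (Eventually.of_forall fun y => norm_nonneg _)
      _ = ∫ t : ℝ, ‖f (e + t * I)‖ := by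
          simp_rw [hshift]
          exact integral_add_right_eq_self (fun t : ℝ => ‖f (e + t * I)‖) z.im
  refine PhragmenLindelof.vertical_strip
    (f := fun s => ∫ y in Icc (-Y) Y, f (s + y * I) * h y) (a := a) (b := b) ?_ ?_
    (fun z hz => (hedge z a hz hfa).trans (le_max_left _ _))
    (fun z hz => (hedge z b hz hfb).trans (le_max_right _ _)) hsa hsb
  · refine DifferentiableOn.diffContOnCl fun z hz => ?_
    refine (differentiableAt_integral_vertical hf hm hb ?_).differentiableWithinAt
    have : z.re ∈ closure (Ioo a b) := by
      have := (continuous_re.closure_preimage_subset (Ioo a b)) hz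
      exact this
    exact ha.trans_le (closure_minimal Ioo_subset_Icc_self isClosed_Icc this).1
  · obtain ⟨M, T, hM⟩ := hg
    -- Shifting the imaginary part by at most |Y| multiplies exp(c|Im z|) by at most exp(c|Y|).
    refine ⟨c, hc, Real.exp (c * |Y|), ?_⟩
    refine IsBigO.of_bound (volume.real (Icc (-Y) Y) * |M|) ?_
    have hlarge : ∀ᶠ z : ℂ in comap (_root_.abs ∘ im) atTop, T + |Y| ≤ |z.im| :=
      (tendsto_comap (f := (_root_.abs ∘ im : ℂ → ℝ))).eventually (eventually_ge_atTop (T + |Y|))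
    filter_upwards [hlarge.filter_mono inf_le_left, mem_inf_of_right (mem_principal_self _)]
      with z hz hzs
    rw [Real.norm_of_nonneg (Real.exp_pos _).le]
    rw [mul_assoc, mul_comm]
    refine norm_setIntegral_le_of_norm_le_const measure_Icc_lt_top fun y hy => ?_
    have hy' : |y| ≤ |Y| := (abs_le.2 hy).trans (le_abs_self Y)
    have him : (z + y * I).im = z.im + y := by simp
    have hre : (z + y * I).re = z.re := by simp
    have h1 : |z.im| ≤ |z.im + y| + |y| := by simpa using abs_sub (z.im + y) y
    have h2 : |z.im + y| ≤ |z.im| + |Y| := (abs_add_le _ _).trans (by linarith)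
    have h3 := hM (z + y * I) (hre ▸ hzs.1.le) (hre ▸ hzs.2.le) (by rw [him]; linarith)
    rw [him] at h3
    calc ‖f (z + y * I) * h y‖ ≤ ‖f (z + y * I)‖ := by
          rw [norm_mul]
          exact mul_le_of_le_one_right (norm_nonneg _) (hb y)
      _ ≤ M * Real.exp (Real.exp (c * |z.im + y|)) := h3
      _ ≤ |M| * Real.exp (Real.exp (c * |z.im + y|)) := by gcongr; exact le_abs_self M
      _ ≤ |M| * Real.exp (Real.exp (c * |Y|) * Real.exp (c * |z.im|)) := by
          rw [← Real.exp_add]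
          gcongr
          nlinarith

theorem integral_norm_vertical_le {f : ℂ → ℂ} {σ₀ a b c : ℝ}
    (hf : DifferentiableOn ℂ f (halfPlane σ₀)) (ha : σ₀ < a) (hc0 : 0 ≤ c)
    (hc : c < Real.pi / (b - a)) (hg : GrowthBound f a b c)
    (hfa : Integrable fun t : ℝ => f (a + t * I)) (hfb : Integrable fun t : ℝ => f (b + t * I))
    (Y : ℝ) {x : ℝ} (hxa : a ≤ x) (hxb : x ≤ b) :
    ∫ y in Icc (-Y) Y, ‖f (x + y * I)‖
      ≤ max (∫ t : ℝ, ‖f (a + t * I)‖) (∫ t : ℝ, ‖f (b + t * I)‖) := by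
  have hcont : Continuous fun y : ℝ => f (x + y * I) :=
    hf.continuousOn.comp_continuous (by fun_prop) fun y => by
      simpa [halfPlane] using ha.trans_le hxa
  -- The dual weight: `f * h` equals ‖f‖, also at zeros of `f`, where the quotient is 0.
  set h : ℝ → ℂ := fun y => (starRingEnd ℂ (f (x + y * I))) / ‖f (x + y * I)‖ with hh
  have hm : Measurable h := by
    have h1 : Measurable fun y : ℝ => f (x + y * I) := hcont.measurable
    exact (continuous_conj.measurable.comp h1).div (measurable_ofReal.comp h1.norm)
  have hb : ∀ y, ‖h y‖ ≤ 1 := fun y => by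
    simp only [hh, norm_div, RCLike.norm_conj, norm_real, norm_norm]
    exact div_self_le_one _
  have key := norm_integral_vertical_le hf ha hc0 hc hg hfa hfb hm hb Y (s := x)
    (by simpa using hxa) (by simpa using hxb)
  have heq : ∀ y : ℝ, f (x + y * I) * h y = (‖f (x + y * I)‖ : ℂ) := fun y => by
    simp only [hh, ← mul_div_assoc, mul_conj']
    by_cases h0 : (‖f (x + y * I)‖ : ℂ) = 0
    · simp [h0]
    · field_simp
  simp_rw [heq] at key
  rw [integral_complex_ofReal, norm_real] at key
  exact (le_abs_self _).trans key

/-- The L¹ norms on the lines inside the strip are uniformly bounded, so `f` is integrable over the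
whole strip. By Fubini the integrals over horizontal segments are then integrable in the height, and
this replaces pointwise decay. -/
theorem integral_vertical_eq {f : ℂ → ℂ} {σ₀ a b c : ℝ}
    (hf : DifferentiableOn ℂ f (halfPlane σ₀)) (ha : σ₀ < a) (hab : a ≤ b) (hc0 : 0 ≤ c)
    (hc : c < Real.pi / (b - a)) (hg : GrowthBound f a b c)
    (hfa : Integrable fun t : ℝ => f (a + t * I)) (hfb : Integrable fun t : ℝ => f (b + t * I)) :
    ∫ t : ℝ, f (a + t * I) = ∫ t : ℝ, f (b + t * I) := by
  set K := max (∫ t : ℝ, ‖f (a + t * I)‖) (∫ t : ℝ, ‖f (b + t * I)‖) with hK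
  have hcont : ContinuousOn (fun p : ℝ × ℝ => f (p.1 + p.2 * I)) (Icc a b ×ˢ univ) :=
    hf.continuousOn.comp (by fun_prop) fun p hp => by
      simpa [halfPlane] using ha.trans_le hp.1.1
  have hint : Integrable (fun p : ℝ × ℝ => f (p.1 + p.2 * I))
      ((volume.restrict (Icc a b)).prod volume) := by
    have hms : AEStronglyMeasurable (fun p : ℝ × ℝ => f (p.1 + p.2 * I))
        ((volume.restrict (Icc a b)).prod volume) := by
      have := hcont.aestronglyMeasurable (μ := (volume : Measure ℝ).prod (volume : Measure ℝ))
        (measurableSet_Icc.prod MeasurableSet.univ)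
      rwa [← Measure.prod_restrict, Measure.restrict_univ] at this
    have hvert : ∀ x ∈ Icc a b, (Integrable fun y : ℝ => f (x + y * I)) ∧
        ∫ y : ℝ, ‖f (x + y * I)‖ ≤ K := by
      intro x hx
      have hcx : Continuous fun y : ℝ => f (x + y * I) :=
        hf.continuousOn.comp_continuous (by fun_prop) fun y => by
          simpa [halfPlane] using ha.trans_le hx.1
      have hcov : AECover (volume : Measure ℝ) atTop fun n : ℝ => Icc (-n) n :=
        aecover_Icc tendsto_neg_atTop_atBot tendsto_id
      have hle := fun Y : ℝ => integral_norm_vertical_le hf ha hc0 hc hg hfa hfb Y hx.1 hx.2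
      have hi := hcov.integrable_of_integral_norm_bounded K
        (fun n => hcx.continuousOn.integrableOn_compact isCompact_Icc) (Eventually.of_forall hle)
      exact ⟨hi, le_of_tendsto (hcov.integral_tendsto_of_countably_generated hi.norm)
        (Eventually.of_forall hle)⟩
    refine (integrable_prod_iff hms).2 ⟨(ae_restrict_iff' measurableSet_Icc).2
      (Eventually.of_forall fun x hx => (hvert x hx).1), ?_⟩
    refine Integrable.mono' (integrable_const K) hms.norm.integral_prod_right'
      ((ae_restrict_iff' measurableSet_Icc).2 (Eventually.of_forall fun x hx => ?_))
    rw [Real.norm_of_nonneg (integral_nonneg fun _ => norm_nonneg _)]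
    exact (hvert x hx).2
  have hH : Integrable fun T : ℝ => ∫ x in Icc a b, ‖f (x + T * I)‖ :=
    hint.integral_norm_prod_right
  set D : ℝ → ℂ := fun T =>
    I * (∫ y in -T..T, f (b + y * I)) - I * (∫ y in -T..T, f (a + y * I)) with hD
  have hlim : Tendsto D atTop
      (𝓝 (I * (∫ t : ℝ, f (b + t * I)) - I * (∫ t : ℝ, f (a + t * I)))) :=
    ((intervalIntegral_tendsto_integral hfb tendsto_neg_atTop_atBot tendsto_id).const_mul I).sub
      ((intervalIntegral_tendsto_integral hfa tendsto_neg_atTop_atBot tendsto_id).const_mul I)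
  have hDle : ∀ T : ℝ, ‖D T‖ ≤
      (∫ x in Icc a b, ‖f (x + T * I)‖) + ∫ x in Icc a b, ‖f (x + (-T : ℝ) * I)‖ := by
    intro T
    have hrect := integral_boundary_rect_eq_zero_of_differentiableOn f (a + (-T : ℝ) * I)
      (b + T * I) (hf.mono fun z hz => by
        have : z.re ∈ uIcc a b := by simpa using hz.1
        rw [uIcc_of_le hab] at this
        exact ha.trans_le this.1)
    simp only [add_re, ofReal_re, mul_re, I_re, mul_zero, ofReal_im, I_im, mul_one, sub_self,
      add_zero, add_im, mul_im, zero_add, smul_eq_mul] at hrect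
    have hDT : D T = (∫ x in a..b, f (x + T * I)) - ∫ x in a..b, f (x + (-T : ℝ) * I) := by
      rw [hD]
      linear_combination hrect
    rw [hDT, intervalIntegral.integral_of_le hab, intervalIntegral.integral_of_le hab,
      ← integral_Icc_eq_integral_Ioc, ← integral_Icc_eq_integral_Ioc]
    exact (norm_sub_le _ _).trans
      (add_le_add (norm_integral_le_integral_norm _) (norm_integral_le_integral_norm _))
  have hDmeas : Continuous D := by
    have hprim : ∀ g : ℝ → ℂ, Integrable g → Continuous fun T : ℝ => ∫ y in -T..T, g y := by
      intro g hgi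
      have h0 : Continuous fun T : ℝ => ∫ y in (0 : ℝ)..T, g y :=
        intervalIntegral.continuous_primitive (fun _ _ => hgi.intervalIntegrable) 0
      have : (fun T : ℝ => ∫ y in -T..T, g y)
          = fun T => (∫ y in (0 : ℝ)..T, g y) - ∫ y in (0 : ℝ)..(-T), g y := by
        ext T
        rw [intervalIntegral.integral_interval_sub_left] <;> exact hgi.intervalIntegrable
      rw [this]
      exact h0.sub (h0.comp continuous_neg)
    exact (continuous_const.mul (hprim _ hfb)).sub (continuous_const.mul (hprim _ hfa))
  have hDint : Integrable D :=
    (hH.add hH.comp_neg).mono' hDmeas.aestronglyMeasurable (Eventually.of_forall hDle)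
  -- `D` is integrable over an infinite interval and has a limit, so the limit is 0.
  have h0 := (hDint.integrableAtFilter atTop).eq_zero_of_tendsto
    (fun s hs => by
      obtain ⟨t, ht⟩ := mem_atTop_sets.1 hs
      exact measure_mono_top (fun x hx => ht x hx) (Real.volume_Ici (a := t))) hlim
  rw [← mul_sub, mul_eq_zero, or_iff_right I_ne_zero, sub_eq_zero] at h0
  exact h0.symm
end DirichletMellin

/-! ### Laplace transforms of functions on the half-line, and series of translates -/

namespace DirichletMellin

theorem norm_mul_exp_neg (z : ℂ) (s : ℂ) (x : ℝ) :
    ‖z * exp (-(s * x))‖ = ‖z‖ * Real.exp (-(s.re * x)) := by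
  rw [norm_mul, norm_exp]
  simp

theorem integrable_laplace_of_re {g : ℝ → ℂ} {s t : ℂ} (h : s.re = t.re)
    (hg : Integrable fun x : ℝ => g x * exp (-(s * x))) :
    Integrable fun x : ℝ => g x * exp (-(t * x)) := by
  refine hg.norm.mono' ?_ (Eventually.of_forall fun x => ?_)
  · have h2 : AEStronglyMeasurable (fun x : ℝ => exp ((s - t) * x)) volume :=
      (by fun_prop : Continuous fun x : ℝ => exp ((s - t) * x)).aestronglyMeasurable
    refine (hg.1.mul h2).congr (Eventually.of_forall fun x => ?_)
    simp only [Pi.mul_apply, mul_assoc, ← exp_add]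
    congr 2
    ring
  · rw [norm_mul_exp_neg, norm_mul_exp_neg, h]

theorem hasDerivAt_laplace {g : ℝ → ℂ} (h0 : ∀ x ≤ 0, g x = 0) {r : ℝ}
    (hg : ∀ c : ℝ, r < c → Integrable fun x : ℝ => g x * exp (-(c * x : ℂ))) {s : ℂ}
    (hs : r < s.re) :
    (Integrable fun x : ℝ => -(x : ℂ) * g x * exp (-(s * x))) ∧
    HasDerivAt (laplace g) (laplace (fun x => -(x : ℂ) * g x) s) s := by
  -- One δ is the radius of the ball around `s`, a second absorbs the factor x through x ≤ exp(δ x)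
  -- / δ. What remains, Re s - 2δ, still exceeds `r`.
  set δ := (s.re - r) / 3 with hδ
  have hδ0 : 0 < δ := by rw [hδ]; linarith
  have hgs : ∀ t : ℂ, r < t.re → Integrable fun x : ℝ => g x * exp (-(t * x)) := fun t ht =>
    integrable_laplace_of_re (s := (t.re : ℂ)) (by simp) (hg t.re ht)
  have hb := ((hgs ((s.re - 2 * δ : ℝ) : ℂ) (by rw [ofReal_re]; linarith)).norm.mul_const δ⁻¹)
  have hmem : ∀ t ∈ Metric.ball s δ, s.re - δ ≤ t.re := fun t ht => by
    have := (abs_re_le_norm (t - s)).trans (mem_ball_iff_norm.1 ht).le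
    rw [sub_re, abs_le] at this
    linarith
  refine hasDerivAt_integral_of_dominated_loc_of_deriv_le (Metric.ball_mem_nhds s hδ0)
    (F := fun t x => g x * exp (-(t * (x : ℝ))))
    (F' := fun t x => -(x : ℂ) * g x * exp (-(t * (x : ℝ))))
    (bound := fun x => ‖g x * exp (-(((s.re - 2 * δ : ℝ) : ℂ) * x))‖ * δ⁻¹) ?_ (hgs s hs) ?_ ?_ ?_ ?_
  · filter_upwards [Metric.ball_mem_nhds s hδ0] with t ht
    exact (hgs t (by linarith [hmem t ht])).1
  · simp_rw [mul_assoc]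
    exact (by fun_prop : Continuous fun x : ℝ => -(x : ℂ)).aestronglyMeasurable.mul (hgs s hs).1
  · refine Eventually.of_forall fun x t ht => ?_
    rw [mul_assoc, norm_mul, norm_mul_exp_neg, norm_mul_exp_neg, norm_neg, norm_real]
    rcases le_or_gt x 0 with hx | hx
    · simp [h0 x hx]
    · have h1 : x ≤ Real.exp (δ * x) * δ⁻¹ := by
        rw [← div_eq_mul_inv, le_div_iff₀ hδ0]
        have := Real.add_one_le_exp (δ * x)
        linarith
      rw [Real.norm_of_nonneg hx.le, ofReal_re]
      calc x * (‖g x‖ * Real.exp (-(t.re * x)))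
          ≤ (Real.exp (δ * x) * δ⁻¹) * (‖g x‖ * Real.exp (-((s.re - δ) * x))) := by
            gcongr
            exact hmem t ht
        _ = ‖g x‖ * (Real.exp (δ * x) * Real.exp (-((s.re - δ) * x))) * δ⁻¹ := by ring
        _ = _ := by
            rw [← Real.exp_add]
            congr 3
            ring
  · exact hb
  · refine Eventually.of_forall fun x t _ => ?_
    have h1 : HasDerivAt (fun t : ℂ => -(t * (x : ℂ))) (-(x : ℂ)) t := by
      exact (hasDerivAt_mul_const (x : ℂ)).neg
    convert! (h1.cexp).const_mul (g x) using 1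
    ring

/-- The Laplace transform of `x ^ j` on `(0, ∞)`. -/
theorem laplace_pow (j : ℕ) : ∀ s : ℂ, 0 < s.re →
    (Integrable fun x : ℝ => (Ioi 0).indicator (fun x : ℝ => (x : ℂ) ^ j) x * exp (-(s * x))) ∧
    laplace ((Ioi 0).indicator fun x : ℝ => (x : ℂ) ^ j) s = j.factorial / s ^ (j + 1) := by
  induction j with
  | zero =>
    intro s hs
    have heq : (fun x : ℝ => (Ioi 0).indicator (fun x : ℝ => (x : ℂ) ^ 0) x * exp (-(s * x)))
        = (Ioi 0).indicator fun x : ℝ => exp (-s * x) := by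
      ext x
      by_cases hx : x ∈ Ioi (0 : ℝ) <;> simp [hx]
    have hs' : (-s).re < 0 := by simpa using hs
    constructor
    · rw [heq, integrable_indicator_iff measurableSet_Ioi]
      exact integrableOn_exp_mul_complex_Ioi hs' 0
    · rw [laplace, heq, integral_indicator measurableSet_Ioi, integral_exp_mul_complex_Ioi hs']
      simp
  | succ j ih =>
    intro s hs
    -- Multiplying by -x under the integral differentiates the transform, so the formula for j + 1
    -- is the derivative of the one for j.
    obtain ⟨h1, h2⟩ := hasDerivAt_laplace (g := (Ioi 0).indicator fun x : ℝ => (x : ℂ) ^ j)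
      (fun x hx => by simp [hx]) (r := 0) (fun c hc => (ih c (by simpa using hc)).1) hs
    have heq : (fun x : ℝ => -(x : ℂ) * (Ioi 0).indicator (fun x : ℝ => (x : ℂ) ^ j) x)
        = fun x => -(Ioi 0).indicator (fun x : ℝ => (x : ℂ) ^ (j + 1)) x := by
      ext x
      by_cases hx : x ∈ Ioi (0 : ℝ)
      · simp only [hx, indicator_of_mem]; ring
      · simp [hx]
    have hs0 : s ≠ 0 := by rintro rfl; simp at hs
    have hd : HasDerivAt (laplace ((Ioi 0).indicator fun x : ℝ => (x : ℂ) ^ j))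
        (-((j + 1).factorial / s ^ (j + 1 + 1))) s := by
      have hev : laplace ((Ioi 0).indicator fun x : ℝ => (x : ℂ) ^ j)
          =ᶠ[𝓝 s] fun s => (j.factorial : ℂ) * (s ^ (j + 1))⁻¹ := by
        filter_upwards [(isOpen_lt continuous_const continuous_re).mem_nhds hs] with t ht
        rw [(ih t ht).2, div_eq_mul_inv]
      refine HasDerivAt.congr_of_eventuallyEq ?_ hev
      convert! ((hasDerivAt_pow (j + 1) s).inv (pow_ne_zero _ hs0)).const_mul (j.factorial : ℂ)
        using 1
      rw [Nat.factorial_succ]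
      field_simp
      push_cast
      ring
    have h3 := hd.unique h2
    rw [heq] at h3
    simp only [mul_assoc] at h1
    constructor
    · refine h1.neg.congr (Eventually.of_forall fun x => ?_)
      have := congrFun heq x
      simp only [Pi.neg_apply, ← mul_assoc, this]
      ring
    · have h4 : laplace (fun x => -(Ioi 0).indicator (fun x : ℝ => (x : ℂ) ^ (j + 1)) x) s
          = -laplace ((Ioi 0).indicator fun x : ℝ => (x : ℂ) ^ (j + 1)) s := by
        simp only [laplace, neg_mul, integral_neg]
      rw [h4] at h3
      exact (neg_injective h3).symm

/-- A pointwise convergent, absolutely convergent series of translates of an `L ^ p` function. -/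
theorem memLp_hasSum_translates {p : ENNReal} (hp : 1 ≤ p) {h F : ℝ → ℂ} (hh : MemLp h p)
    {ω : ℕ → ℂ} (hω : Summable fun n => ‖ω n‖) (y : ℕ → ℝ)
    (hF : ∀ x, HasSum (fun n => ω n * h (x - y n)) (F x)) : MemLp F p := by
  have hterm : ∀ n, AEStronglyMeasurable (fun x => ω n * h (x - y n)) volume := fun n =>
    ((hh.1.comp_measurePreserving (measurePreserving_sub_right volume (y n)))).const_mul (ω n)
  have hnorm : ∀ n, eLpNorm (fun x => ω n * h (x - y n)) p volume ≤ ‖ω n‖ₑ * eLpNorm h p := by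
    intro n
    refine eLpNorm_const_smul_le (c := ω n) (f := fun x => h (x - y n)) |>.trans_eq ?_
    rw [← eLpNorm_comp_measurePreserving hh.1 (measurePreserving_sub_right volume (y n))]
    rfl
  have hpart : ∀ N, AEStronglyMeasurable
      (∑ n ∈ Finset.range N, fun x => ω n * h (x - y n)) volume := fun N =>
    Finset.aestronglyMeasurable_sum _ fun n _ => hterm n
  have hlim : ∀ x, Tendsto (fun N => (∑ n ∈ Finset.range N, fun x => ω n * h (x - y n)) x)
      atTop (𝓝 (F x)) := fun x => by
    simpa only [Finset.sum_apply] using (hF x).tendsto_sum_nat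
  refine ⟨aestronglyMeasurable_of_tendsto_ae atTop hpart (Eventually.of_forall hlim), ?_⟩
  have hfin : (∑' n, ‖ω n‖ₑ) * eLpNorm h p < ⊤ :=
    ENNReal.mul_lt_top (by simpa [← ofReal_norm, lt_top_iff_ne_top] using hω.tsum_ofReal_ne_top) hh.2
  refine lt_of_le_of_lt ?_ hfin
  -- Fatou reduces to partial sums; Minkowski and translation invariance bound these by the total
  -- weight times the norm of `h`.
  refine (Lp.eLpNorm_lim_le_liminf_eLpNorm hpart F (Eventually.of_forall hlim)).trans ?_
  refine liminf_le_of_le (by isBoundedDefault) fun b hb => ?_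
  obtain ⟨N, hN⟩ := hb.exists
  refine hN.trans ((eLpNorm_sum_le (fun n _ => hterm n) hp).trans ?_)
  rw [← ENNReal.tsum_mul_right]
  exact (Finset.sum_le_sum fun n _ => hnorm n).trans (ENNReal.sum_le_tsum _)
end DirichletMellin

/-! ### The auxiliary function in the coordinate x = exp(-y) -/

namespace DirichletMellin

theorem mellinConvergent_iff_integrable_laplace {h : ℝ → ℂ} {s : ℂ} :
    MellinConvergent h s ↔ Integrable fun x : ℝ => h (Real.exp (-x)) * exp (-(s * x)) := by
  have himg : (fun x : ℝ => Real.exp (-x)) '' univ = Ioi 0 := by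
    rw [image_univ]
    ext y
    refine ⟨?_, fun hy => ⟨-Real.log y, by simp [Real.exp_log hy]⟩⟩
    rintro ⟨x, rfl⟩
    exact Real.exp_pos _
  rw [MellinConvergent, ← himg, integrableOn_image_iff_integrableOn_abs_deriv_smul
    (f := fun x => Real.exp (-x)) (f' := fun x => -Real.exp (-x)) MeasurableSet.univ
    (fun x _ => (by simpa using! (hasDerivAt_neg x).exp :
      HasDerivAt (fun x => Real.exp (-x)) (-Real.exp (-x)) x).hasDerivWithinAt)
    (Real.exp_injective.comp neg_injective).injOn, integrableOn_univ]
  refine iff_of_eq (congrArg (fun u => Integrable u volume) (funext fun x => ?_))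
  have h1 : ((Real.exp (-x) : ℝ) : ℂ) ^ (s - 1) = exp (-(s * x)) * exp x := by
    rw [cpow_def_of_ne_zero (by simp), ← ofReal_log (Real.exp_pos _).le, Real.log_exp, ← exp_add]
    congr 1
    push_cast
    ring
  rw [abs_neg, abs_of_pos (Real.exp_pos _), h1, real_smul, smul_eq_mul, ofReal_exp, ofReal_neg]
  calc exp (-(x : ℂ)) * (exp (-(s * x)) * exp x * h (Real.exp (-x)))
      = (exp (-(x : ℂ)) * exp x) * (exp (-(s * x)) * h (Real.exp (-x))) := by ring
    _ = _ := by rw [← exp_add, neg_add_cancel, exp_zero, one_mul, mul_comm]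

/-- `φ` restricted to `(0, 1)`. -/
noncomputable def cutoff (φ : ℝ → ℂ) : ℝ → ℂ := (Ioo 0 1).indicator φ

/-- `φ` restricted to `(0, 1)`, in the coordinate `x = exp (-y)`. -/
noncomputable def pull (φ : ℝ → ℂ) (y : ℝ) : ℂ := cutoff φ (Real.exp (-y))

variable {φ : ℝ → ℂ} {σ₀ : ℝ}

theorem pull_of_nonpos {y : ℝ} (hy : y ≤ 0) : pull φ y = 0 := by
  refine indicator_of_notMem (fun h => ?_) φ
  have := h.2
  rw [Real.exp_lt_one_iff] at this
  linarith

theorem mellin_cutoff (hφ : IsAuxiliary φ σ₀) (s : ℂ) : mellin (cutoff φ) s = mellin φ s := by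
  refine setIntegral_congr_ae measurableSet_Ioi ?_
  filter_upwards [compl_mem_ae_iff.2 (measure_singleton (1 : ℝ))] with x hx hx0
  rcases lt_or_gt_of_ne (show x ≠ 1 from hx) with h | h
  · rw [cutoff, indicator_of_mem (show x ∈ Ioo 0 1 from ⟨hx0, h⟩)]
  · rw [cutoff, indicator_of_notMem (fun h' => h.not_gt h'.2), hφ.eq_zero x h]

theorem laplace_pull (hφ : IsAuxiliary φ σ₀) (s : ℂ) : laplace (pull φ) s = mellin φ s := by
  rw [← mellin_cutoff hφ, mellin_eq_fourier]
  conv_lhs => rw [← re_add_im s]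
  rw [laplace_eq_fourier]
  refine congrArg (fun f : ℝ → ℂ => FourierTransform.fourier f (s.im / (2 * Real.pi)))
    (funext fun x => ?_)
  rw [pull, real_smul, mul_comm]
  push_cast
  ring_nf

theorem aestronglyMeasurable_cutoff (hφ : IsAuxiliary φ σ₀) :
    AEStronglyMeasurable (cutoff φ) (volume.restrict (Ioi 0)) :=
  hφ.measurable.aestronglyMeasurable.indicator measurableSet_Ioo

/-- The only delicate point is 1, where |φ|² is O((1 - x)^(-2σ₁)); this is integrable precisely
because σ₁ < 1/2. -/
theorem locallyIntegrableOn_norm_sq_cutoff (hφ : IsAuxiliary φ σ₀) :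
    LocallyIntegrableOn (fun x => ‖cutoff φ x‖ ^ 2) (Ioi 0) := by
  obtain ⟨σ₁, hσ₁, hO⟩ := hφ.isBigO_one
  have hms : AEStronglyMeasurable (fun x => ‖cutoff φ x‖ ^ 2) (volume.restrict (Ioi 0)) :=
    (aestronglyMeasurable_cutoff hφ).norm.pow 2
  have hmf : ∀ x : ℝ, StronglyMeasurableAtFilter (fun x => ‖cutoff φ x‖ ^ 2) (𝓝[Ioi 0] x) volume :=
    fun x => ⟨Ioi 0, self_mem_nhdsWithin, hms⟩
  intro x hx
  rcases lt_trichotomy x 1 with h | rfl | h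
  · obtain ⟨C, hC⟩ := hφ.locallyBounded x ⟨hx, h⟩
    have hb : (fun x => ‖cutoff φ x‖ ^ 2) =O[𝓝[Ioi 0] x] fun _ => (1 : ℝ) := by
      refine IsBigO.of_bound (C ^ 2) ((hC.filter_mono nhdsWithin_le_nhds).mono fun y hy => ?_)
      rw [norm_pow, norm_norm, norm_one, mul_one]
      exact pow_le_pow_left₀ (norm_nonneg _) ((norm_indicator_le_norm_self φ y).trans hy) 2
    exact hb.integrableAtFilter (hmf x)
      ((continuous_const.locallyIntegrable (μ := volume) x).filter_mono nhdsWithin_le_nhds)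
  · have hb : (fun x => ‖cutoff φ x‖ ^ 2) =O[𝓝[Ioi 0] 1] fun y : ℝ => (1 - y) ^ (-σ₁ * 2) := by
      refine IsBigO.mono ?_ nhdsWithin_le_nhds
      rw [← nhdsLT_sup_nhdsGE]
      refine IsBigO.sup ?_ ?_
      · have h2 : (fun x => ‖φ x‖ ^ 2) =O[𝓝[<] 1] fun y : ℝ => ((1 - y) ^ (-σ₁)) ^ 2 :=
          hO.norm_left.pow 2
        refine (IsBigO.of_bound 1 ?_).trans (h2.congr' EventuallyEq.rfl ?_)
        · refine Eventually.of_forall fun y => ?_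
          rw [one_mul, norm_pow, norm_norm, norm_pow, norm_norm]
          exact pow_le_pow_left₀ (norm_nonneg _) (norm_indicator_le_norm_self φ y) 2
        · filter_upwards [self_mem_nhdsWithin] with y hy
          rw [← Real.rpow_natCast, ← Real.rpow_mul (sub_nonneg.2 (le_of_lt hy))]
          norm_num
      · refine IsBigO.of_bound 1 ?_
        filter_upwards [self_mem_nhdsWithin] with y hy
        rw [cutoff, indicator_of_notMem fun h' => (not_lt.2 hy) h'.2]
        simp
    refine hb.integrableAtFilter (hmf 1) (IntegrableAtFilter.filter_mono nhdsWithin_le_nhds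
      ⟨Ioo 0 2, Ioo_mem_nhds one_pos one_lt_two, ?_⟩)
    have h1 : IntervalIntegrable (fun y : ℝ => (1 - y) ^ (-σ₁ * 2)) volume 0 2 := by
      have := (intervalIntegral.intervalIntegrable_rpow' (a := 1) (b := -1) (r := -σ₁ * 2)
        (by linarith)).comp_sub_left 1
      norm_num at this
      simpa using this
    exact ((intervalIntegrable_iff_integrableOn_Ioc_of_le zero_le_two).1 h1).mono_set
      Ioo_subset_Ioc_self
  · refine ⟨Ioi 1, mem_nhdsWithin_of_mem_nhds (Ioi_mem_nhds h), ?_⟩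
    refine (integrableOn_zero).congr_fun (fun y hy => ?_) measurableSet_Ioi
    rw [cutoff, indicator_of_notMem fun h' => (not_lt.2 (le_of_lt hy)) h'.2]
    simp

theorem locallyIntegrableOn_cutoff (hφ : IsAuxiliary φ σ₀) :
    LocallyIntegrableOn (cutoff φ) (Ioi 0) := by
  have h1 : LocallyIntegrableOn (fun x => 1 + ‖cutoff φ x‖ ^ 2) (Ioi 0) :=
    (continuous_const.locallyIntegrable.locallyIntegrableOn _).add
      (locallyIntegrableOn_norm_sq_cutoff hφ)
  intro x hx
  obtain ⟨t, ht, hi⟩ := h1 x hx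
  refine ⟨t ∩ Ioi 0, inter_mem ht self_mem_nhdsWithin, Integrable.mono (hi.mono_set inter_subset_left)
    ((aestronglyMeasurable_cutoff hφ).mono_set inter_subset_right)
    (Eventually.of_forall fun x => ?_)⟩
  rw [Real.norm_of_nonneg (by positivity)]
  nlinarith [sq_nonneg (‖cutoff φ x‖ - 1)]

theorem cutoff_isBigO_atTop (a : ℝ) : cutoff φ =O[atTop] fun x : ℝ => x ^ (-a) := by
  refine IsBigO.of_bound 1 ?_
  filter_upwards [eventually_ge_atTop 1] with x hx
  rw [cutoff, indicator_of_notMem fun h => h.2.not_ge hx]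
  simp

theorem cutoff_isBigO_zero (hφ : IsAuxiliary φ σ₀) :
    cutoff φ =O[𝓝[>] 0] fun x : ℝ => x ^ (-σ₀) :=
  (IsBigO.of_bound 1 (Eventually.of_forall fun x => by
    rw [one_mul]; exact norm_indicator_le_norm_self φ x)).trans hφ.isBigO_zero

theorem differentiableAt_mellin (hφ : IsAuxiliary φ σ₀) {s : ℂ} (hs : σ₀ < s.re) :
    DifferentiableAt ℂ (mellin φ) s := by
  rw [← funext (mellin_cutoff hφ)]
  exact mellin_differentiableAt_of_isBigO_rpow (locallyIntegrableOn_cutoff hφ)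
    (cutoff_isBigO_atTop (s.re + 1)) (by linarith) (cutoff_isBigO_zero hφ) hs

theorem integrable_pull (hφ : IsAuxiliary φ σ₀) {s : ℂ} (hs : σ₀ < s.re) :
    Integrable fun x : ℝ => pull φ x * exp (-(s * x)) :=
  mellinConvergent_iff_integrable_laplace.1
    (mellinConvergent_of_isBigO_rpow (locallyIntegrableOn_cutoff hφ)
      (cutoff_isBigO_atTop (s.re + 1)) (by linarith) (cutoff_isBigO_zero hφ) hs)

/-- The squared norm is the Mellin integrand of |φ|² at 2c. Near 0, |φ|² is O(x^(-2σ₀)), so the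
integral converges since 2c > 2σ₀. -/
theorem memLp_pull (hφ : IsAuxiliary φ σ₀) {c : ℝ} (hc : σ₀ < c) :
    MemLp (fun x : ℝ => pull φ x * exp (-(c * x : ℂ))) 2 := by
  rw [memLp_two_iff_integrable_sq_norm (integrable_pull hφ (s := (c : ℂ)) (by simpa using hc)).1]
  have hsq : ∀ {l : Filter ℝ} {b : ℝ}, l ≤ 𝓟 (Ioi 0) → cutoff φ =O[l] (fun x : ℝ => x ^ (-b)) →
      (fun x => ((‖cutoff φ x‖ ^ 2 : ℝ) : ℂ)) =O[l] fun x : ℝ => x ^ (-(2 * b)) := by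
    intro l b hl hb
    have h2 := (hb.norm_left.pow 2).congr' (f₂ := fun x => ‖cutoff φ x‖ ^ 2)
      (g₂ := fun x : ℝ => x ^ (-(2 * b))) EventuallyEq.rfl (by
        filter_upwards [le_principal_iff.1 hl] with x hx
        rw [← Real.rpow_natCast, ← Real.rpow_mul (le_of_lt hx)]
        congr 1
        push_cast
        ring)
    refine (IsBigO.of_bound 1 (Eventually.of_forall fun x => ?_)).trans h2
    rw [norm_real, one_mul]
  have hm : MellinConvergent (fun x => ((‖cutoff φ x‖ ^ 2 : ℝ) : ℂ)) ((2 * c : ℝ) : ℂ) :=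
    mellinConvergent_of_isBigO_rpow (a := 2 * (c + 1)) (b := 2 * σ₀)
      (fun x hx => let ⟨t, ht, hi⟩ := locallyIntegrableOn_norm_sq_cutoff hφ x hx
        ⟨t, ht, hi.ofReal⟩)
      (hsq (le_principal_iff.2 (Ioi_mem_atTop 0)) (cutoff_isBigO_atTop (c + 1)))
      (by rw [ofReal_re]; linarith)
      (hsq (le_principal_iff.2 self_mem_nhdsWithin) (cutoff_isBigO_zero hφ))
      (by rw [ofReal_re]; linarith)
  refine (mellinConvergent_iff_integrable_laplace.1 hm).norm.congr (Eventually.of_forall fun x => ?_)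
  simp only [norm_mul_exp_neg, pull, mul_pow, norm_real, norm_pow, norm_norm, ofReal_re]
  rw [← Real.exp_nat_mul]
  congr 2
  push_cast
  ring

/-- Since `pull φ` lives on x > 0, the absolute integral decreases as Re s grows. The bound is
independent of Im s, so φ̂ does not affect growth in a strip. -/
theorem norm_mellin_le (hφ : IsAuxiliary φ σ₀) {c : ℝ} (hc : σ₀ < c) {s : ℂ} (hs : c ≤ s.re) :
    ‖mellin φ s‖ ≤ ∫ x : ℝ, ‖pull φ x * exp (-(c * x : ℂ))‖ := by
  rw [← laplace_pull hφ]
  refine (norm_integral_le_integral_norm _).trans (integral_mono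
    (integrable_pull hφ (hc.trans_le hs)).norm
    (integrable_pull hφ (s := (c : ℂ)) (by simpa using hc)).norm fun x => ?_)
  simp only [norm_mul_exp_neg, ofReal_re]
  rcases le_or_gt x 0 with hx | hx
  · simp [pull_of_nonpos hx]
  · gcongr
end DirichletMellin

/-! ### The Dirichlet sum as a series of translates -/

namespace DirichletMellin

/-- The sum `∑_{1 ≤ n < u} a n φ(n / u)` at `u = exp x`. -/
noncomputable def expSum (a : ℕ → ℂ) (φ : ℝ → ℂ) (x : ℝ) : ℂ :=
  ∑ n ∈ Finset.Ico 1 ⌈Real.exp x⌉₊, a n * φ ((n : ℝ) / Real.exp x)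

variable {a : ℕ → ℂ} {φ : ℝ → ℂ} {σ₀ : ℝ}

theorem expSum_of_nonpos {x : ℝ} (hx : x ≤ 0) : expSum a φ x = 0 := by
  have : ⌈Real.exp x⌉₊ ≤ 1 := Nat.ceil_le.2 (by simpa using hx)
  rw [expSum, Finset.Ico_eq_empty_of_le this, Finset.sum_empty]

/-- In exponential coordinates φ(n / exp x) is `pull φ` at x - log n, and exp(-s x) is n^(-s) times
exp(-s(x - log n)). The support of `pull φ` enforces n < exp x, and `LSeries.term` vanishes at n =
0. -/
theorem hasSum_expSum (s : ℂ) (x : ℝ) :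
    HasSum (fun n : ℕ => LSeries.term a s n *
      (pull φ (x - Real.log n) * exp (-(s * ((x - Real.log n : ℝ) : ℂ)))))
      (expSum a φ x * exp (-(s * x))) := by
  have hpull : ∀ n : ℕ, n ≠ 0 →
      pull φ (x - Real.log n) = cutoff φ ((n : ℝ) / Real.exp x) := by
    intro n hn
    rw [pull, neg_sub, Real.exp_sub, Real.exp_log (by positivity)]
  have hterm : ∀ n : ℕ, n ≠ 0 → LSeries.term a s n *
      (pull φ (x - Real.log n) * exp (-(s * ((x - Real.log n : ℝ) : ℂ))))
      = a n * cutoff φ ((n : ℝ) / Real.exp x) * exp (-(s * x)) := by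
    intro n hn
    have hn' : (n : ℂ) ≠ 0 := by exact_mod_cast hn
    have h1 : exp (-(s * ((x - Real.log n : ℝ) : ℂ))) = exp (-(s * x)) * (n : ℂ) ^ s := by
      rw [cpow_def_of_ne_zero hn', ← exp_add, ← natCast_log]
      congr 1
      push_cast
      ring
    rw [LSeries.term_of_ne_zero hn, hpull n hn, h1]
    have h2 : (n : ℂ) ^ s ≠ 0 := by simp [cpow_eq_zero_iff, hn']
    field_simp
  rw [expSum, Finset.sum_mul]
  have hcong : ∀ n ∈ Finset.Ico 1 ⌈Real.exp x⌉₊, a n * φ ((n : ℝ) / Real.exp x) * exp (-(s * x))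
      = LSeries.term a s n *
        (pull φ (x - Real.log n) * exp (-(s * ((x - Real.log n : ℝ) : ℂ)))) := by
    intro n hn
    rw [Finset.mem_Ico, Nat.lt_ceil] at hn
    rw [hterm n (by omega), cutoff, indicator_of_mem]
    have : (0 : ℝ) < n := by exact_mod_cast hn.1
    exact ⟨by positivity, (div_lt_one (Real.exp_pos x)).2 hn.2⟩
  rw [Finset.sum_congr rfl hcong]
  refine hasSum_sum_of_ne_finset_zero fun n hn => ?_
  rcases eq_or_ne n 0 with rfl | h0
  · simp
  · rw [hterm n h0, cutoff, indicator_of_notMem, mul_zero, zero_mul]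
    rintro ⟨-, h⟩
    rw [div_lt_one (Real.exp_pos x)] at h
    exact hn (Finset.mem_Ico.2 ⟨Nat.one_le_iff_ne_zero.2 h0, Nat.lt_ceil.2 h⟩)

theorem lseriesSummable (ha : ∀ ε : ℝ, 0 < ε → a =O[atTop] fun n : ℕ => (n : ℝ) ^ ε) {s : ℂ}
    (hs : 1 < s.re) : LSeriesSummable a s :=
  LSeriesSummable_of_isBigO_rpow (x := (1 + s.re) / 2) (by linarith) (ha _ (by linarith))

theorem integrable_expSum (ha : ∀ ε : ℝ, 0 < ε → a =O[atTop] fun n : ℕ => (n : ℝ) ^ ε)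
    (hφ : IsAuxiliary φ σ₀) (hσ : σ₀ < 1) {s : ℂ} (hs : 1 < s.re) :
    Integrable fun x : ℝ => expSum a φ x * exp (-(s * x)) :=
  memLp_one_iff_integrable.1 <| memLp_hasSum_translates le_rfl
    (memLp_one_iff_integrable.2 (integrable_pull hφ (hσ.trans hs)))
    (lseriesSummable ha hs).norm (fun n => Real.log n) fun x => hasSum_expSum s x

theorem memLp_expSum (ha : ∀ ε : ℝ, 0 < ε → a =O[atTop] fun n : ℕ => (n : ℝ) ^ ε)
    (hφ : IsAuxiliary φ σ₀) (hσ : σ₀ < 1) {c : ℝ} (hc : 1 < c) :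
    MemLp (fun x : ℝ => expSum a φ x * exp (-(c * x : ℂ))) 2 :=
  memLp_hasSum_translates one_le_two (memLp_pull hφ (hσ.trans hc))
    (lseriesSummable ha (s := c) hc).norm (fun n => Real.log n) fun x => hasSum_expSum c x

theorem laplace_expSum (ha : ∀ ε : ℝ, 0 < ε → a =O[atTop] fun n : ℕ => (n : ℝ) ^ ε)
    (hφ : IsAuxiliary φ σ₀) (hσ : σ₀ < 1) {s : ℂ} (hs : 1 < s.re) :
    laplace (expSum a φ) s = LSeries a s * mellin φ s := by
  have hp := integrable_pull hφ (hσ.trans hs)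
  have hint := hasSum_integral_of_summable_integral_norm (μ := volume)
    (F := fun (n : ℕ) (x : ℝ) => LSeries.term a s n *
      (pull φ (x - Real.log n) * exp (-(s * ((x - Real.log n : ℝ) : ℂ)))))
    (fun n => (hp.comp_sub_right (Real.log n)).const_mul _) (by
      have : ∀ n : ℕ, ∫ x : ℝ, ‖LSeries.term a s n *
          (pull φ (x - Real.log n) * exp (-(s * ((x - Real.log n : ℝ) : ℂ))))‖
          = ‖LSeries.term a s n‖ * ∫ x : ℝ, ‖pull φ x * exp (-(s * x))‖ := fun n => by
        simp_rw [norm_mul (LSeries.term a s n)]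
        rw [integral_const_mul,
          integral_sub_right_eq_self (fun x : ℝ => ‖pull φ x * exp (-(s * x))‖) (Real.log n)]
      simp_rw [this]
      exact (lseriesSummable ha hs).norm.mul_right _)
  simp_rw [(hasSum_expSum s _).tsum_eq] at hint
  have heq : ∀ n : ℕ, ∫ x : ℝ, LSeries.term a s n *
      (pull φ (x - Real.log n) * exp (-(s * ((x - Real.log n : ℝ) : ℂ))))
      = LSeries.term a s n * mellin φ s := fun n => by
    rw [integral_const_mul, integral_sub_right_eq_self (fun x : ℝ => pull φ x * exp (-(s * x))),
      ← laplace_pull hφ, laplace]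
  simp_rw [heq] at hint
  exact hint.unique ((lseriesSummable ha hs).hasSum.mul_right _)
end DirichletMellin

/-! ### Principal part, residue and growth of the holomorphic part -/

namespace DirichletMellin

theorem exists_principal_part {U : Set ℂ} {z₀ : ℂ} (hU : U ∈ 𝓝 z₀) {N : ℂ → ℂ}
    (hN : DifferentiableOn ℂ N U) (m : ℕ) :
    ∃ (c : ℕ → ℂ) (G : ℂ → ℂ), DifferentiableOn ℂ G U ∧ ∀ s ≠ z₀,
      N s / (s - z₀) ^ m = (∑ j ∈ Finset.range m, c j / (s - z₀) ^ (j + 1)) + G s := by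
  induction m with
  | zero => exact ⟨0, N, hN, by simp⟩
  | succ m ih =>
    obtain ⟨c, G, hG, h⟩ := ih
    -- One more division by s - z₀ shifts the old coefficients up by one and splits G / (s - z₀)
    -- into G(z₀) / (s - z₀) and the holomorphic slope.
    refine ⟨fun j => Nat.casesOn j (G z₀) c, dslope G z₀,
      (differentiableOn_dslope hU).2 hG, fun s hs => ?_⟩
    have hs' : s - z₀ ≠ 0 := sub_ne_zero.2 hs
    rw [pow_succ, ← div_div, h s hs, Finset.sum_range_succ', add_div, Finset.sum_div,
      dslope_of_ne _ hs, slope_def_field, add_assoc]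
    congr 1
    · refine Finset.sum_congr rfl fun j _ => ?_
      rw [pow_succ _ (j + 1), div_div]
    · simp only [zero_add, pow_one]
      rw [← add_div]
      congr 1
      exact (add_sub_cancel _ _).symm

/-- Data describing `f` in `Re s > σ₀` as a principal part at `1` plus a holomorphic function. -/
structure IsPolarDecomposition (f : ℂ → ℂ) (σ₀ : ℝ) (m : ℕ) (c : ℕ → ℂ) (G : ℂ → ℂ) : Prop where
  differentiableOn : DifferentiableOn ℂ G (halfPlane σ₀)
  eq_add : ∀ s ∈ halfPlane σ₀, (m = 0 ∨ s ≠ 1) →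
    f s = (∑ j ∈ Finset.range m, c j / (s - 1) ^ (j + 1)) + G s

theorem isOpen_halfPlane (σ : ℝ) : IsOpen (halfPlane σ) := isOpen_lt continuous_const continuous_re

theorem exists_polarDecomposition {a : ℕ → ℂ} {φ : ℝ → ℂ} {σ₀ : ℝ} {L : ℂ → ℂ}
    (hL : IsContinuedDirichletSeries a σ₀ L) (hφ : IsAuxiliary φ σ₀) :
    ∃ (c : ℕ → ℂ) (G : ℂ → ℂ),
      IsPolarDecomposition (fun s => L s * mellin φ s) σ₀ (poleOrder L 1) c G := by
  have hone : (1 : ℂ) ∈ halfPlane σ₀ := by simpa [halfPlane] using hL.lt_one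
  have hU := (isOpen_halfPlane σ₀).mem_nhds hone
  have hmel : DifferentiableOn ℂ (mellin φ) (halfPlane σ₀) := fun s hs =>
    (differentiableAt_mellin hφ hs).differentiableWithinAt
  -- Pole order 0 does not fix the meromorphic order, since `L` may vanish at 1. Positive pole order
  -- forces the order to be its negative.
  rcases Nat.eq_zero_or_pos (poleOrder L 1) with h0 | hpos
  · refine ⟨0, fun s => L s * mellin φ s, DifferentiableOn.mul (fun s hs => ?_) hmel, fun s _ _ => ?_⟩
    · by_cases h : s = 1
      · exact h ▸ (hL.analyticAt_one h0).differentiableAt.differentiableWithinAt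
      · exact (hL.analyticAt_of_ne s hs h).differentiableAt.differentiableWithinAt
    · simp [h0]
  · set m := poleOrder L 1 with hm
    have hord : meromorphicOrderAt L 1 = ((-(m : ℤ) : ℤ) : WithTop ℤ) := by
      have hpos' := hpos
      rw [hm, poleOrder] at hpos'
      have h1 : (m : ℤ) = -(meromorphicOrderAt L 1).untop₀ := by
        rw [hm, poleOrder]
        omega
      have h2 : meromorphicOrderAt L 1 ≠ ⊤ := by
        intro h
        rw [h] at hpos'
        simp at hpos'
      rw [h1, neg_neg, WithTop.coe_untop₀_of_ne_top h2]
    obtain ⟨g, hg, -, hLg⟩ := (meromorphicOrderAt_eq_int_iff hL.meromorphicAt_one).1 hord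
    -- The stored value of `L` at the pole is arbitrary, so the removable singularity is filled by
    -- hand.
    set N : ℂ → ℂ := Function.update (fun s => (s - 1) ^ m * L s) 1 (g 1) with hNdef
    have hNne : ∀ s ≠ 1, N s = (s - 1) ^ m * L s := fun s hs => Function.update_of_ne hs _ _
    have hN : DifferentiableOn ℂ N (halfPlane σ₀) := by
      intro s hs
      refine DifferentiableAt.differentiableWithinAt ?_
      by_cases h : s = 1
      · subst h
        refine hg.differentiableAt.congr_of_eventuallyEq ?_
        rw [eventually_nhdsWithin_iff] at hLg
        filter_upwards [hLg] with z hz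
        by_cases h : z = 1
        · rw [h, hNdef, Function.update_self]
        · have hz' : z - 1 ≠ 0 := sub_ne_zero.2 h
          rw [hNne z h, hz h, zpow_neg, zpow_natCast, smul_eq_mul, ← mul_assoc,
            mul_inv_cancel₀ (pow_ne_zero _ hz'), one_mul]
      · refine DifferentiableAt.congr_of_eventuallyEq (f := fun s => (s - 1) ^ m * L s) ?_ ?_
        · exact (by fun_prop : DifferentiableAt ℂ (fun s : ℂ => (s - 1) ^ m) s).mul
            (hL.analyticAt_of_ne s hs h).differentiableAt
        · filter_upwards [isOpen_ne.mem_nhds h] with z hz using hNne z hz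
    obtain ⟨c, G, hG, h⟩ := exists_principal_part hU (hN.mul hmel) m
    refine ⟨c, G, hG, fun s hs h1 => ?_⟩
    have hs1 : s ≠ 1 := h1.resolve_left hpos.ne'
    have hs' : s - 1 ≠ 0 := sub_ne_zero.2 hs1
    rw [← h s hs1, Pi.mul_apply, hNne s hs1]
    field_simp

/-- Cauchy's formula for the j-th derivative of u^s at 1, which is u (log u)^j, handles each polar
term; the holomorphic part integrates to 0. -/
theorem residue_mul_cpow {f : ℂ → ℂ} {σ₀ : ℝ} {m : ℕ} {c : ℕ → ℂ} {G : ℂ → ℂ} (hσ : σ₀ < 1)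
    (h : IsPolarDecomposition f σ₀ m c G) {u : ℝ} (hu : 0 < u) :
    residue (fun s => f s * (u : ℂ) ^ s) 1
      = ∑ j ∈ Finset.range m, c j * (u * (Real.log u : ℂ) ^ j / j.factorial) := by
  have hu' : (u : ℂ) ≠ 0 := by exact_mod_cast hu.ne'
  have hiter : ∀ j : ℕ, iteratedDeriv j (fun s : ℂ => (u : ℂ) ^ s) =
      fun s => (Real.log u : ℂ) ^ j * (u : ℂ) ^ s := by
    intro j
    induction j with
    | zero => simp
    | succ j ih =>
      rw [iteratedDeriv_succ, ih]
      ext s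
      have : HasDerivAt (fun s : ℂ => (Real.log u : ℂ) ^ j * (u : ℂ) ^ s) _ s :=
        ((hasDerivAt_id s).const_cpow (c := (u : ℂ)) (Or.inl hu')).const_mul _
      rw [this.deriv, ofReal_log hu.le, id, mul_one]
      ring
  have hdiff : Differentiable ℂ fun s : ℂ => (u : ℂ) ^ s := fun s =>
    ((hasDerivAt_id s).const_cpow (Or.inl hu')).differentiableAt
  have hR : ∀ᶠ R : ℝ in 𝓝[>] 0, (2 * Real.pi * I : ℂ)⁻¹ * ∮ z in C(1, R), f z * (u : ℂ) ^ z
      = ∑ j ∈ Finset.range m, c j * (u * (Real.log u : ℂ) ^ j / j.factorial) := by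
    filter_upwards [Ioo_mem_nhdsGT (sub_pos.2 hσ)] with R hR
    have hball : Metric.closedBall (1 : ℂ) R ⊆ halfPlane σ₀ := fun z hz => by
      have := (abs_re_le_norm (z - 1)).trans (mem_closedBall_iff_norm.1 hz)
      rw [sub_re, abs_le, one_re] at this
      have h2 := hR.2
      change σ₀ < z.re
      linarith
    have hne : ∀ z ∈ Metric.sphere (1 : ℂ) R, z - 1 ≠ 0 := fun z hz h0 => by
      rw [mem_sphere_iff_norm, h0, norm_zero] at hz
      exact hR.1.ne hz
    have hcongr : EqOn (fun z => f z * (u : ℂ) ^ z)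
        (fun z => (∑ j ∈ Finset.range m, c j • ((1 / (z - 1) ^ (j + 1)) • (u : ℂ) ^ z))
          + G z * (u : ℂ) ^ z) (Metric.sphere 1 R) := fun z hz => by
      simp only
      rw [h.eq_add z (hball (Metric.sphere_subset_closedBall hz)) (Or.inr (sub_ne_zero.1 (hne z hz))),
        add_mul, Finset.sum_mul]
      congr 1
      refine Finset.sum_congr rfl fun j _ => ?_
      simp only [smul_eq_mul]
      ring
    have hGc : DifferentiableOn ℂ (fun z => G z * (u : ℂ) ^ z) (Metric.closedBall 1 R) :=
      (h.differentiableOn.mono hball).mul hdiff.differentiableOn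
    have hint : ∀ j, CircleIntegrable
        (fun z => c j • ((1 / (z - 1) ^ (j + 1)) • (u : ℂ) ^ z)) 1 R := fun j => by
      have hc : ContinuousOn (fun z : ℂ => (1 / (z - 1) ^ (j + 1)) • (u : ℂ) ^ z)
          (Metric.sphere 1 R) :=
        ContinuousOn.smul (continuousOn_const.div
          (by fun_prop : Continuous fun z : ℂ => (z - 1) ^ (j + 1)).continuousOn
          fun z hz => pow_ne_zero _ (hne z hz)) hdiff.continuous.continuousOn
      exact ContinuousOn.circleIntegrable hR.1.le (hc.const_smul (c j))
    rw [circleIntegral.integral_congr hR.1.le hcongr, circleIntegral.integral_add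
      (by simpa only [Finset.sum_fn] using CircleIntegrable.sum _ fun j _ => hint j)
      ((hGc.continuousOn.mono Metric.sphere_subset_closedBall).circleIntegrable hR.1.le),
      circleIntegral_eq_zero_of_differentiable_on_off_countable hR.1.le countable_empty
        hGc.continuousOn (fun z hz => hGc.differentiableAt
          (Filter.mem_of_superset (Metric.isOpen_ball.mem_nhds hz.1) Metric.ball_subset_closedBall)),
      add_zero, circleIntegral.integral_fun_sum fun j _ => hint j, Finset.mul_sum]
    refine Finset.sum_congr rfl fun j _ => ?_
    rw [circleIntegral.integral_smul,
      hdiff.differentiableOn.circleIntegral_one_div_sub_center_pow_smul hR.1 j, hiter]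
    beta_reduce
    rw [cpow_one]
    have := two_pi_I_ne_zero
    have hpi : (Real.pi : ℂ) ≠ 0 := by exact_mod_cast Real.pi_ne_zero
    simp only [smul_eq_mul]
    have hf : (j.factorial : ℂ) ≠ 0 := by exact_mod_cast j.factorial_ne_zero
    field_simp
  exact (tendsto_const_nhds.congr' (hR.mono fun _ h => h.symm)).limUnder_eq

theorem growthBound_of_polarDecomposition {a : ℕ → ℂ} {φ : ℝ → ℂ} {σ₀ : ℝ} {L : ℂ → ℂ}
    (hL : IsContinuedDirichletSeries a σ₀ L) (hφ : IsAuxiliary φ σ₀) {c : ℕ → ℂ} {G : ℂ → ℂ}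
    (h : IsPolarDecomposition (fun s => L s * mellin φ s) σ₀ (poleOrder L 1) c G)
    {r b : ℝ} (hr : σ₀ < r) {κ : ℝ} (hκ : 0 < κ) : GrowthBound G r b κ := by
  obtain ⟨A, hA⟩ := hL.finiteOrder
  obtain ⟨C, hC⟩ := hA.bound
  set m := poleOrder L 1
  -- A positive exponent dominating `A`; the replacement is legitimate because ‖s‖ ≥ 1 in the range
  -- used.
  set B := max |A| 1 with hB
  set K := ∫ x : ℝ, ‖pull φ x * exp (-(r * x : ℂ))‖ with hK
  have hK0 : 0 ≤ K := integral_nonneg fun _ => norm_nonneg _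
  obtain ⟨R, hR⟩ : ∃ R : ℝ, ∀ s : ℂ, R ≤ ‖s‖ → s ∈ halfPlane σ₀ →
      ‖(s - 1) ^ m * L s‖ ≤ C * Real.exp (‖s‖ ^ A) := by
    rw [eventually_inf_principal, ← comap_norm_atTop, eventually_comap, eventually_atTop] at hC
    obtain ⟨R, hR⟩ := hC
    refine ⟨R, fun s hs hs' => ?_⟩
    have := hR ‖s‖ hs s rfl hs'
    rwa [Real.norm_of_nonneg (Real.exp_pos _).le] at this
  obtain ⟨T₀, hT₀⟩ : ∃ T₀ : ℝ, ∀ y ≥ T₀, (2 * y) ^ B ≤ Real.exp (κ * y) := by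
    have h1 := (isLittleO_rpow_exp_pos_mul_atTop B (half_pos hκ)).bound one_pos
    have h2 : Tendsto (fun y : ℝ => 2 * y) atTop atTop :=
      tendsto_id.const_mul_atTop two_pos
    obtain ⟨T, hT⟩ := eventually_atTop.1 (h2.eventually h1)
    refine ⟨T, fun y hy => ?_⟩
    have := hT y hy
    rw [one_mul, Real.norm_of_nonneg (Real.exp_pos _).le] at this
    refine (le_abs_self _).trans (this.trans_eq ?_)
    congr 1
    ring
  -- For |Im s| past this threshold the bounds from `R` and `T₀` apply, ‖s - 1‖ ≥ 1 makes the polar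
  -- terms harmless, and |Re s| ≤ |Im s| gives ‖s‖ ≤ 2|Im s|.
  refine ⟨|C| * K + ∑ j ∈ Finset.range m, ‖c j‖,
    max (max R T₀) (max 1 (max |r| |b|)), fun s hsr hsb hT => ?_⟩
  simp only [max_le_iff] at hT
  obtain ⟨⟨hTR, hTT⟩, hT1, hTr, hTb⟩ := hT
  have hs : s ∈ halfPlane σ₀ := hr.trans_le hsr
  have hre : |s.re| ≤ |s.im| := by
    rw [abs_le]
    constructor
    · linarith [neg_abs_le r]
    · linarith [le_abs_self b]
  have hn1 : |s.im| ≤ ‖s‖ := abs_im_le_norm s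
  have hn2 : ‖s‖ ≤ 2 * |s.im| := (norm_le_abs_re_add_abs_im s).trans (by linarith)
  have hs1 : 1 ≤ ‖s - 1‖ := hT1.trans (by simpa using abs_im_le_norm (s - 1))
  have hne : s ≠ 1 := by
    rintro rfl
    norm_num at hs1
  have hLs : ‖L s‖ ≤ |C| * Real.exp (Real.exp (κ * |s.im|)) := by
    have h1 := hR s (hTR.trans hn1) hs
    rw [norm_mul, norm_pow] at h1
    have h2 : ‖s‖ ^ A ≤ Real.exp (κ * |s.im|) := calc
      ‖s‖ ^ A ≤ ‖s‖ ^ B := Real.rpow_le_rpow_of_exponent_le (hT1.trans hn1)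
        ((le_abs_self A).trans (le_max_left _ _))
      _ ≤ (2 * |s.im|) ^ B := Real.rpow_le_rpow (norm_nonneg _) hn2 (by positivity)
      _ ≤ _ := hT₀ _ hTT
    calc ‖L s‖ ≤ ‖s - 1‖ ^ m * ‖L s‖ :=
          le_mul_of_one_le_left (norm_nonneg _) (one_le_pow₀ hs1)
      _ ≤ C * Real.exp (‖s‖ ^ A) := h1
      _ ≤ |C| * Real.exp (‖s‖ ^ A) := by gcongr; exact le_abs_self C
      _ ≤ _ := by gcongr
  have hmel : ‖mellin φ s‖ ≤ K := norm_mellin_le hφ hr hsr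
  have hQ : ‖∑ j ∈ Finset.range m, c j / (s - 1) ^ (j + 1)‖ ≤ ∑ j ∈ Finset.range m, ‖c j‖ := by
    refine (norm_sum_le _ _).trans (Finset.sum_le_sum fun j _ => ?_)
    rw [norm_div, norm_pow]
    exact div_le_self (norm_nonneg _) (one_le_pow₀ hs1)
  have hG : G s = L s * mellin φ s - ∑ j ∈ Finset.range m, c j / (s - 1) ^ (j + 1) := by
    have := h.eq_add s hs (Or.inr hne)
    rw [this, add_sub_cancel_left]
  have hexp : 1 ≤ Real.exp (Real.exp (κ * |s.im|)) := Real.one_le_exp (Real.exp_pos _).le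
  calc ‖G s‖ ≤ ‖L s‖ * ‖mellin φ s‖ + ∑ j ∈ Finset.range m, ‖c j‖ := by
        rw [hG, ← norm_mul]
        exact (norm_sub_le _ _).trans (by gcongr)
    _ ≤ |C| * Real.exp (Real.exp (κ * |s.im|)) * K
        + (∑ j ∈ Finset.range m, ‖c j‖) * Real.exp (Real.exp (κ * |s.im|)) := by
        gcongr
        exact le_mul_of_one_le_right (Finset.sum_nonneg fun _ _ => norm_nonneg _) hexp
    _ = _ := by ring
end DirichletMellin

/-! ### Square integrability of a function and of the boundary values of its transform -/

namespace DirichletMellin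

theorem eLpNorm_two_eq {f : ℝ → ℂ} (hf : MemLp f 2) :
    eLpNorm f 2 = ENNReal.ofReal (Real.sqrt (∫ t, ‖f t‖ ^ 2)) := by
  rw [hf.eLpNorm_eq_integral_rpow_norm two_ne_zero ENNReal.ofNat_ne_top, Real.sqrt_eq_rpow]
  norm_num

theorem aestronglyMeasurable_laplace {g : ℝ → ℂ} {s t : ℂ}
    (hg : AEStronglyMeasurable (fun x : ℝ => g x * exp (-(s * x))) volume) :
    AEStronglyMeasurable (fun x : ℝ => g x * exp (-(t * x))) volume := by
  have h2 : AEStronglyMeasurable (fun x : ℝ => exp ((s - t) * x)) volume :=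
    (by fun_prop : Continuous fun x : ℝ => exp ((s - t) * x)).aestronglyMeasurable
  refine (hg.mul h2).congr (Eventually.of_forall fun x => ?_)
  simp only [Pi.mul_apply, mul_assoc, ← exp_add]
  congr 2
  ring

theorem memLp_exp_neg_indicator {δ : ℝ} (hδ : 0 < δ) :
    MemLp ((Ioi 0).indicator fun x : ℝ => exp (-(δ * x : ℂ))) 2 := by
  have hc : Continuous fun x : ℝ => exp (-(δ * x : ℂ)) := by fun_prop
  rw [memLp_indicator_iff_restrict measurableSet_Ioi,
    memLp_two_iff_integrable_sq_norm hc.aestronglyMeasurable]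
  refine (exp_neg_integrableOn_Ioi 0 (b := 2 * δ) (by positivity)).congr_fun (fun x _ => ?_)
    measurableSet_Ioi
  have := norm_mul_exp_neg 1 δ x
  rw [one_mul, norm_one, one_mul, ofReal_re] at this
  simp only [this]
  rw [← Real.exp_nat_mul]
  congr 1
  push_cast
  ring

/-- If `g exp (-r x)` is square integrable then so is any holomorphic function, on the line
`Re s = r`, continuing the Laplace transform of `g`. -/
theorem memLp_boundary_of_memLp {g : ℝ → ℂ} {G : ℂ → ℂ} {σ₀ r : ℝ} (h0 : ∀ x ≤ 0, g x = 0)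
    (hG : DifferentiableOn ℂ G (halfPlane σ₀)) (hr : σ₀ < r)
    (hgG : ∀ s : ℂ, 1 < s.re → laplace g s = -G s)
    (hg : MemLp (fun x : ℝ => g x * exp (-(r * x : ℂ))) 2) :
    MemLp (fun t : ℝ => G (r + t * I)) 2 := by
  have hle : ∀ c : ℝ, r ≤ c → ∀ x : ℝ,
      ‖g x * exp (-(c * x : ℂ))‖ ≤ ‖g x * exp (-(r * x : ℂ))‖ := by
    intro c hc x
    rw [norm_mul_exp_neg, norm_mul_exp_neg]
    rcases le_or_gt x 0 with hx | hx
    · simp [h0 x hx]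
    · simp only [ofReal_re]
      gcongr
  have h2 : ∀ c : ℝ, r ≤ c → MemLp (fun x : ℝ => g x * exp (-(c * x : ℂ))) 2 := fun c hc =>
    hg.of_le (aestronglyMeasurable_laplace hg.1) (Eventually.of_forall (hle c hc))
  have h1 : ∀ c : ℝ, r < c → Integrable fun x : ℝ => g x * exp (-(c * x : ℂ)) := by
    intro c hc
    -- Cauchy–Schwarz: on x > 0 the function is the product of g exp(-r x) and exp(-(c - r)x), both
    -- square integrable.
    refine (hg.integrable_mul (memLp_exp_neg_indicator (sub_pos.2 hc))).congr
      (Eventually.of_forall fun x => ?_)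
    simp only [Pi.mul_apply]
    rcases le_or_gt x 0 with hx | hx
    · simp [h0 x hx]
    · rw [indicator_of_mem (show x ∈ Ioi 0 from hx), mul_assoc, ← exp_add]
      congr 2
      push_cast
      ring
  have hlap : DifferentiableOn ℂ (laplace g) (halfPlane r) := fun s hs =>
    (hasDerivAt_laplace h0 h1 hs).2.differentiableAt.differentiableWithinAt
  have hsub : halfPlane r ⊆ halfPlane σ₀ := fun s hs => hr.trans hs
  have heq : EqOn (laplace g) (fun s => -G s) (halfPlane r) := by
    -- The base point max(r, 1) + 1 lies in both half-planes Re s > r and Re s > 1.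
    refine (hlap.analyticOnNhd (isOpen_halfPlane r)).eqOn_of_preconnected_of_eventuallyEq
      ((hG.mono hsub).neg.analyticOnNhd (isOpen_halfPlane r))
      (convex_halfSpace_re_gt r).isPreconnected (z₀ := ((max r 1 + 1 : ℝ) : ℂ)) ?_ ?_
    · change r < _
      rw [ofReal_re]
      linarith [le_max_left r 1]
    · filter_upwards [(isOpen_halfPlane 1).mem_nhds
        (show ((max r 1 + 1 : ℝ) : ℂ) ∈ halfPlane 1 from by
          change 1 < (((max r 1 + 1 : ℝ) : ℂ)).re
          rw [ofReal_re]
          linarith [le_max_right r 1])] with s hs using hgG s hs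
  set c : ℕ → ℝ := fun n => r + 1 / ((n : ℝ) + 1) with hc
  have hcr : ∀ n, r < c n := fun n => by
    have : (0 : ℝ) < 1 / ((n : ℝ) + 1) := by positivity
    simp only [hc]
    linarith
  have hclim : Tendsto c atTop (𝓝 r) := by
    simpa [hc] using tendsto_one_div_add_atTop_nhds_zero_nat.const_add r
  have hmem : ∀ t : ℝ, (r + t * I : ℂ) ∈ halfPlane σ₀ := fun t => by
    simpa [halfPlane] using hr
  have hms : AEStronglyMeasurable (fun t : ℝ => G (r + t * I)) volume :=
    (hG.continuousOn.comp_continuous (by fun_prop) hmem).aestronglyMeasurable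
  refine ⟨hms, ?_⟩
  have hFatou := Lp.eLpNorm_lim_le_liminf_eLpNorm (p := 2) (μ := volume)
    (f := fun (n : ℕ) (t : ℝ) => laplace g (c n + t * I))
    (fun n => (memLp_laplace (h1 _ (hcr n)) (h2 _ (hcr n).le)).1)
    (fun t : ℝ => -G (r + t * I)) (Eventually.of_forall fun t => by
      have hcont : ContinuousAt (fun s => -G s) (r + t * I : ℂ) :=
        (hG.continuousOn.continuousAt ((isOpen_halfPlane σ₀).mem_nhds (hmem t))).neg
      have hl : Tendsto (fun n => (c n + t * I : ℂ)) atTop (𝓝 (r + t * I)) :=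
        ((continuous_ofReal.tendsto r).comp hclim).add_const _
      refine (hcont.tendsto.comp hl).congr fun n => ?_
      exact (heq (by simpa [halfPlane] using hcr n)).symm)
  have hneg : eLpNorm (fun t : ℝ => -G (r + t * I)) 2 volume
      = eLpNorm (fun t : ℝ => G (r + t * I)) 2 volume := eLpNorm_neg _ _ _
  rw [hneg] at hFatou
  refine (hFatou.trans (liminf_le_of_le (by isBoundedDefault) fun b hb => ?_)).trans_lt
    (ENNReal.ofReal_lt_top
      (r := Real.sqrt (2 * Real.pi * ∫ x : ℝ, ‖g x * exp (-(r * x : ℂ))‖ ^ 2)))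
  obtain ⟨n, hn⟩ := hb.exists
  refine hn.trans ?_
  rw [eLpNorm_two_eq (memLp_laplace (h1 _ (hcr n)) (h2 _ (hcr n).le)),
    integral_norm_sq_laplace (h1 _ (hcr n)) (h2 _ (hcr n).le)]
  refine ENNReal.ofReal_le_ofReal (Real.sqrt_le_sqrt ?_)
  refine mul_le_mul_of_nonneg_left (integral_mono ?_ ?_ fun x => ?_) (by positivity)
  · exact (memLp_two_iff_integrable_sq_norm (h2 _ (hcr n).le).1).1 (h2 _ (hcr n).le)
  · exact (memLp_two_iff_integrable_sq_norm hg.1).1 hg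
  · exact pow_le_pow_left₀ (norm_nonneg _) (hle _ (hcr n).le x) 2

theorem GrowthBound.mul_bounded {f e : ℂ → ℂ} {a b c K : ℝ} (hf : GrowthBound f a b c)
    (he : ∀ s : ℂ, a ≤ s.re → s.re ≤ b → ‖e s‖ ≤ K) :
    GrowthBound (fun s => f s * e s) a b c := by
  obtain ⟨M, T, h⟩ := hf
  refine ⟨M * K, T, fun s ha hb hT => ?_⟩
  rw [norm_mul, mul_right_comm]
  exact mul_le_mul (h s ha hb hT) (he s ha hb) (norm_nonneg _) ((norm_nonneg _).trans (h s ha hb hT))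

open ComplexConjugate in
theorem laplace_conj (k : ℝ → ℂ) (s : ℂ) :
    laplace (fun x => conj (k x)) s = conj (laplace k (conj s)) := by
  rw [laplace, laplace, ← integral_conj]
  refine integral_congr_ae (Eventually.of_forall fun x => ?_)
  simp [← exp_conj]

open ComplexConjugate in
/-- If the Laplace transform of `g` continues to a function of moderate growth which is square
integrable on the line `Re s = r`, then `g exp (-r x)` is square integrable. -/
theorem memLp_of_memLp_boundary {g : ℝ → ℂ} {G : ℂ → ℂ} {σ₀ r : ℝ} (h0 : ∀ x ≤ 0, g x = 0)
    (hG : DifferentiableOn ℂ G (halfPlane σ₀)) (hr : σ₀ < r)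
    (hgG : ∀ s : ℂ, 1 < s.re → laplace g s = -G s)
    (hg1 : ∀ c : ℝ, 1 < c → Integrable fun x : ℝ => g x * exp (-(c * x : ℂ)))
    (hg2 : ∀ c : ℝ, 1 < c → MemLp (fun x : ℝ => g x * exp (-(c * x : ℂ))) 2)
    (hgrowth : ∀ b κ : ℝ, 0 < κ → GrowthBound G r b κ)
    (hGr : MemLp (fun t : ℝ => G (r + t * I)) 2) :
    MemLp (fun x : ℝ => g x * exp (-(r * x : ℂ))) 2 := by
  set b := max r 1 + 1 with hb
  have hrb : r < b := by rw [hb]; linarith [le_max_left r 1]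
  have hb1 : 1 < b := by rw [hb]; linarith [le_max_right r 1]
  have hbound : ∀ X : ℝ, IntegrableOn (fun x : ℝ => ‖g x * exp (-(r * x : ℂ))‖ ^ 2) (Iic X) ∧
      2 * Real.pi * ∫ x in Iic X, ‖g x * exp (-(r * x : ℂ))‖ ^ 2
        ≤ ∫ t : ℝ, ‖G (r + t * I)‖ ^ 2 := by
    intro X
    -- With support in (0, X], `k` has an entire transform and a finite weighted norm, so that norm
    -- can later be absorbed.
    set k : ℝ → ℂ := (Iic X).indicator g with hk
    have hk0 : ∀ x ≤ 0, k x = 0 := fun x hx => by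
      rw [hk, indicator_apply, h0 x hx, ite_self]
    have hkp : ∀ (p : ENNReal), MemLp (fun x : ℝ => g x * exp (-(b * x : ℂ))) p → ∀ c : ℝ,
        MemLp (fun x : ℝ => k x * exp (-(c * x : ℂ))) p := by
      intro p hp c
      have hind : MemLp ((Iic X).indicator fun x : ℝ => g x * exp (-(b * x : ℂ))) p :=
        hp.indicator measurableSet_Iic
      have hkb : MemLp (fun x : ℝ => k x * exp (-(b * x : ℂ))) p := by
        convert! hind using 2 with x
        by_cases hx : x ∈ Iic X <;> simp [hk, hx]
      refine hkb.of_le_mul (c := Real.exp (|b - c| * |X|)) (aestronglyMeasurable_laplace hkb.1)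
        (Eventually.of_forall fun x => ?_)
      rw [norm_mul_exp_neg, norm_mul_exp_neg, ofReal_re, ofReal_re]
      rcases le_or_gt x 0 with hx | hx
      · simp [hk0 x hx]
      · by_cases hxX : x ∈ Iic X
        · rw [mul_left_comm, ← Real.exp_add]
          gcongr
          have h1 : (b - c) * x ≤ |b - c| * |X| :=
            mul_le_mul (le_abs_self _) ((show x ≤ X from hxX).trans (le_abs_self X)) hx.le
              (abs_nonneg _)
          linarith
        · simp [hk, hxX]
    have hk2 := hkp 2 (hg2 b hb1)
    have hk1 : ∀ c : ℝ, Integrable fun x : ℝ => k x * exp (-(c * x : ℂ)) := fun c =>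
      memLp_one_iff_integrable.1 (hkp 1 (memLp_one_iff_integrable.2 (hg1 b hb1)) c)
    have hkc : ∀ c : ℝ, Integrable fun x : ℝ => conj (k x) * exp (-(c * x : ℂ)) := fun c => by
      have := (memLp_one_iff_integrable.2 (hk1 c)).star
      refine (memLp_one_iff_integrable.1 this).congr (Eventually.of_forall fun x => ?_)
      simp [← exp_conj]
    -- Conjugation composed with reflection in Re s = r: `E` is holomorphic and on that line is the
    -- conjugate of the transform of `k`.
    set E : ℂ → ℂ := fun s => laplace (fun x => conj (k x)) (2 * r - s) with hE
    have hEeq : ∀ c t : ℝ, E (c + t * I) = conj (laplace k ((2 * r - c : ℝ) + t * I)) := by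
      intro c t
      simp only [hE, laplace_conj]
      congr 2
      apply Complex.ext <;> simp
    have hEd : Differentiable ℂ E := fun s =>
      (hasDerivAt_laplace (r := (2 * r - s : ℂ).re - 1) (fun x hx => by simp [hk0 x hx])
        (fun c _ => hkc c) (sub_one_lt _)).2.differentiableAt.comp s
          (by fun_prop : DifferentiableAt ℂ (fun s : ℂ => 2 * (r : ℂ) - s) s)
    have hEb : ∀ s : ℂ, r ≤ s.re → s.re ≤ b →
        ‖E s‖ ≤ ∫ x : ℝ, ‖conj (k x) * exp (-(((2 * r - b : ℝ) : ℂ) * x))‖ := by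
      intro s _ hs
      refine (norm_integral_le_integral_norm _).trans (integral_mono ?_ (hkc _).norm fun x => ?_)
      · exact (integrable_laplace_of_re (s := (((2 * r - s : ℂ).re : ℝ) : ℂ)) (by simp)
          (hkc _)).norm
      · simp only [norm_mul_exp_neg]
        rcases le_or_gt x 0 with hx | hx
        · simp [hk0 x hx]
        · refine mul_le_mul_of_nonneg_left (Real.exp_le_exp.2 (neg_le_neg
            (mul_le_mul_of_nonneg_right ?_ hx.le))) (norm_nonneg _)
          have : (2 * r - s : ℂ).re = 2 * r - s.re := by simp
          rw [this, ofReal_re]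
          linarith
    have hErL : MemLp (fun t : ℝ => E (r + t * I)) 2 := by
      have := (memLp_laplace (hk1 r) (hk2 r)).star
      refine (memLp_congr_ae (Eventually.of_forall fun t => ?_)).1 this
      rw [hEeq]
      simp only [Pi.star_apply, two_mul, add_sub_cancel_right]
      rfl
    -- Reflection sends Re s = b to Re s = 2r - b; the factor exp((2b - 2r)x) brings the transform
    -- back to Re s = b, where Parseval against `g` applies.
    have hEbeq : ∀ t : ℝ, E (b + t * I)
        = conj (laplace (fun x => k x * exp ((2 * b - 2 * r) * x)) (b + t * I)) := by
      intro t
      rw [hEeq, laplace, laplace]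
      congr 1
      refine integral_congr_ae (Eventually.of_forall fun x => ?_)
      simp only [mul_assoc, ← exp_add]
      congr 2
      push_cast
      ring
    have hheq : ∀ x : ℝ, k x * exp ((2 * b - 2 * r) * x) * exp (-(b * x : ℂ))
        = k x * exp (-(((2 * r - b : ℝ) : ℂ) * x)) := by
      intro x
      rw [mul_assoc, ← exp_add]
      congr 2
      push_cast
      ring
    have hh1 : Integrable fun x : ℝ => k x * exp ((2 * b - 2 * r) * x) * exp (-(b * x : ℂ)) := by
      simp_rw [hheq]
      exact hk1 _
    have hh2 : MemLp (fun x : ℝ => k x * exp ((2 * b - 2 * r) * x) * exp (-(b * x : ℂ))) 2 := by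
      simp_rw [hheq]
      exact hk2 _
    have hEbL : MemLp (fun t : ℝ => E (b + t * I)) 2 := by
      have := (memLp_laplace hh1 hh2).star
      refine (memLp_congr_ae (Eventually.of_forall fun t => ?_)).1 this
      rw [hEbeq]
      rfl
    have hGb : ∀ t : ℝ, G (b + t * I) = -laplace g (b + t * I) := fun t => by
      rw [hgG _ (by simpa using hb1), neg_neg]
    have hGbL : MemLp (fun t : ℝ => G (b + t * I)) 2 := by
      simp_rw [hGb]
      exact (memLp_laplace (hg1 b hb1) (hg2 b hb1)).neg
    have hshift := integral_vertical_eq (f := fun s => G s * E s) (a := r) (b := b)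
      (c := Real.pi / (b - r) / 2) (hG.mul hEd.differentiableOn) hr hrb.le
      (by have := sub_pos.2 hrb; positivity)
      (half_lt_self (div_pos Real.pi_pos (sub_pos.2 hrb)))
      ((hgrowth b _ (by have := sub_pos.2 hrb; positivity)).mul_bounded hEb)
      (hGr.integrable_mul hErL) (hGbL.integrable_mul hEbL)
    have hparseval := integral_conj_laplace_mul_laplace hh1 hh2 (hg1 b hb1) (hg2 b hb1)
    simp_rw [← hEbeq, hheq] at hparseval
    -- The exponents 2r - b and b add up to 2r, which leaves the weight belonging to the line Re s =
    -- r.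
    have hsq : ∀ x : ℝ, conj (k x * exp (-(((2 * r - b : ℝ) : ℂ) * x)))
        * (g x * exp (-(b * x : ℂ))) = ((‖k x * exp (-(r * x : ℂ))‖ ^ 2 : ℝ) : ℂ) := by
      intro x
      have hkg : conj (k x) * g x = conj (k x) * k x := by
        by_cases hx : x ∈ Iic X <;> simp [hk, hx]
      rw [ofReal_pow, ← conj_mul', map_mul, map_mul, ← exp_conj, ← exp_conj]
      simp only [map_neg, map_mul, conj_ofReal]
      calc _ = (conj (k x) * g x) *
            (exp (-(((2 * r - b : ℝ) : ℂ) * x)) * exp (-(b * x : ℂ))) := by ring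
        _ = (conj (k x) * k x) * (exp (-(r * x : ℂ)) * exp (-(r * x : ℂ))) := by
            rw [hkg, ← exp_add, ← exp_add]
            congr 2
            push_cast
            ring
        _ = _ := by ring
    simp_rw [hsq] at hparseval
    rw [integral_complex_ofReal] at hparseval
    have hW : 2 * Real.pi * ∫ x : ℝ, ‖k x * exp (-(r * x : ℂ))‖ ^ 2
        = ‖∫ t : ℝ, G (r + t * I) * E (r + t * I)‖ := by
      rw [hshift]
      have h1 : ∀ t : ℝ, G (b + t * I) * E (b + t * I)
          = -(E (b + t * I) * laplace g (b + t * I)) := fun t => by rw [hGb]; ring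
      simp_rw [h1]
      rw [integral_neg, norm_neg, hparseval, norm_mul, norm_mul, norm_real, norm_real,
        Real.norm_of_nonneg Real.pi_pos.le,
        Real.norm_of_nonneg (integral_nonneg fun _ => sq_nonneg _)]
      simp
    have hErI := (memLp_two_iff_integrable_sq_norm hErL.1).1 hErL
    have hGrI := (memLp_two_iff_integrable_sq_norm hGr.1).1 hGr
    have hEr : ∫ t : ℝ, ‖E (r + t * I)‖ ^ 2
        = 2 * Real.pi * ∫ x : ℝ, ‖k x * exp (-(r * x : ℂ))‖ ^ 2 := by
      rw [← integral_norm_sq_laplace (hk1 r) (hk2 r)]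
      simp_rw [hEeq, RCLike.norm_conj, two_mul, add_sub_cancel_right]
    have hle : ‖∫ t : ℝ, G (r + t * I) * E (r + t * I)‖
        ≤ ∫ t : ℝ, (‖G (r + t * I)‖ ^ 2 + ‖E (r + t * I)‖ ^ 2) / 2 := by
      refine norm_integral_le_of_norm_le ((hGrI.add hErI).div_const 2)
        (Eventually.of_forall fun t => ?_)
      rw [norm_mul]
      nlinarith [sq_nonneg (‖G (r + t * I)‖ - ‖E (r + t * I)‖)]
    -- Both sides now contain the same finite quantity W, in the form W ≤ (‖G‖² + W) / 2.
    rw [integral_div, integral_add hGrI hErI, hEr, ← hW] at hle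
    have hkind : (fun x : ℝ => ‖k x * exp (-(r * x : ℂ))‖ ^ 2)
        = (Iic X).indicator fun x : ℝ => ‖g x * exp (-(r * x : ℂ))‖ ^ 2 := by
      ext x
      by_cases hx : x ∈ Iic X <;> simp [hk, hx]
    have hkI := (memLp_two_iff_integrable_sq_norm (hk2 r).1).1 (hk2 r)
    rw [hkind] at hkI hle
    rw [integral_indicator measurableSet_Iic] at hle
    exact ⟨(integrable_indicator_iff measurableSet_Iic).1 hkI, by linarith⟩
  have hms : AEStronglyMeasurable (fun x : ℝ => g x * exp (-(r * x : ℂ))) volume :=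
    aestronglyMeasurable_laplace (hg1 b hb1).1
  rw [memLp_two_iff_integrable_sq_norm hms]
  refine (aecover_Iic tendsto_id : AECover volume atTop fun X : ℝ => Iic X)
    |>.integrable_of_integral_norm_bounded
      ((∫ t : ℝ, ‖G (r + t * I)‖ ^ 2) / (2 * Real.pi)) (fun X => (hbound X).1)
      (Eventually.of_forall fun X => ?_)
  rw [le_div_iff₀ (by positivity), mul_comm]
  simpa only [norm_pow, norm_norm] using (hbound X).2
end DirichletMellin

/-! ### The transform of ψ and the conclusion -/

namespace DirichletMellin

/-- `ψ` in the coordinate `u = exp x`, restricted to `x > 0`. -/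
noncomputable def expPsi (a : ℕ → ℂ) (L : ℂ → ℂ) (φ : ℝ → ℂ) : ℝ → ℂ :=
  (Ioi 0).indicator fun x => psi a L φ (Real.exp x)

/-- The residue term in the coordinate `u = exp x`, restricted to `x > 0`. -/
noncomputable def polarTerm (m : ℕ) (c : ℕ → ℂ) (x : ℝ) : ℂ :=
  ∑ j ∈ Finset.range m,
    c j / j.factorial * ((Ioi 0).indicator (fun x : ℝ => (x : ℂ) ^ j) x * exp x)

theorem polarTerm_mul_exp (m : ℕ) (c : ℕ → ℂ) (s : ℂ) (x : ℝ) :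
    polarTerm m c x * exp (-(s * x)) = ∑ j ∈ Finset.range m, c j / j.factorial *
      ((Ioi 0).indicator (fun x : ℝ => (x : ℂ) ^ j) x * exp (-((s - 1) * x))) := by
  rw [polarTerm, Finset.sum_mul]
  refine Finset.sum_congr rfl fun j _ => ?_
  rw [mul_assoc, mul_assoc, ← exp_add]
  congr 3
  ring

theorem integrable_polarTerm (m : ℕ) (c : ℕ → ℂ) {s : ℂ} (hs : 1 < s.re) :
    Integrable fun x : ℝ => polarTerm m c x * exp (-(s * x)) := by
  simp_rw [polarTerm_mul_exp]
  exact integrable_finsetSum _ fun j _ => ((laplace_pow j (s - 1) (by simpa using hs)).1.const_mul _)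

theorem laplace_polarTerm (m : ℕ) (c : ℕ → ℂ) {s : ℂ} (hs : 1 < s.re) :
    laplace (polarTerm m c) s = ∑ j ∈ Finset.range m, c j / (s - 1) ^ (j + 1) := by
  have hs' : 0 < (s - 1).re := by simpa using hs
  simp_rw [laplace, polarTerm_mul_exp]
  rw [integral_finsetSum _ fun j _ => ((laplace_pow j (s - 1) hs').1.const_mul _)]
  refine Finset.sum_congr rfl fun j _ => ?_
  have := (laplace_pow j (s - 1) hs').2
  rw [laplace] at this
  rw [integral_const_mul, this]
  have hf : (j.factorial : ℂ) ≠ 0 := by exact_mod_cast j.factorial_ne_zero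
  field_simp

theorem memLp_polarTerm (m : ℕ) (c : ℕ → ℂ) {b : ℝ} (hb : 1 < b) :
    MemLp (fun x : ℝ => polarTerm m c x * exp (-(b * x : ℂ))) 2 := by
  simp_rw [polarTerm_mul_exp]
  refine memLp_finsetSum _ fun j _ => MemLp.const_mul ?_ _
  have h1 := (laplace_pow j (b - 1 : ℂ) (by simpa using hb)).1
  rw [memLp_two_iff_integrable_sq_norm h1.1]
  -- The square of x^j exp(-(b - 1)x) is a function of the same kind, with both parameters doubled.
  refine (laplace_pow (2 * j) (2 * (b - 1) : ℂ) (by simpa using hb)).1.norm.congr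
    (Eventually.of_forall fun x => ?_)
  simp only
  rw [norm_mul_exp_neg, norm_mul_exp_neg, mul_pow, ← Real.exp_nat_mul]
  congr 1
  · by_cases hx : x ∈ Ioi (0 : ℝ)
    · simp only [indicator_of_mem hx, norm_pow, ← pow_mul, mul_comm]
    · simp [indicator_of_notMem hx]
  · congr 1
    simp
    ring

variable {a : ℕ → ℂ} {φ : ℝ → ℂ} {σ₀ : ℝ} {L : ℂ → ℂ} {c : ℕ → ℂ} {G : ℂ → ℂ}

theorem expPsi_eq (hL : IsContinuedDirichletSeries a σ₀ L)
    (h : IsPolarDecomposition (fun s => L s * mellin φ s) σ₀ (poleOrder L 1) c G) (x : ℝ) :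
    expPsi a L φ x = polarTerm (poleOrder L 1) c x - expSum a φ x := by
  by_cases hx : x ∈ Ioi (0 : ℝ)
  · rw [expPsi, indicator_of_mem hx, psi, residue_mul_cpow hL.lt_one h (Real.exp_pos x)]
    rw [expSum, polarTerm, Real.log_exp]
    congr 1
    refine Finset.sum_congr rfl fun j _ => ?_
    rw [indicator_of_mem hx, ofReal_exp]
    ring
  · rw [expPsi, indicator_of_notMem hx, expSum_of_nonpos (not_lt.1 hx), polarTerm]
    simp [indicator_of_notMem hx]

theorem expPsi_of_nonpos {x : ℝ} (hx : x ≤ 0) : expPsi a L φ x = 0 :=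
  indicator_of_notMem (not_lt.2 hx) _

theorem integrable_expPsi (hL : IsContinuedDirichletSeries a σ₀ L) (hφ : IsAuxiliary φ σ₀)
    (h : IsPolarDecomposition (fun s => L s * mellin φ s) σ₀ (poleOrder L 1) c G) {s : ℂ}
    (hs : 1 < s.re) : Integrable fun x : ℝ => expPsi a L φ x * exp (-(s * x)) := by
  simp_rw [expPsi_eq hL h, sub_mul]
  exact (integrable_polarTerm _ _ hs).sub (integrable_expSum hL.coeff_isBigO hφ hL.lt_one hs)

theorem memLp_expPsi (hL : IsContinuedDirichletSeries a σ₀ L) (hφ : IsAuxiliary φ σ₀)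
    (h : IsPolarDecomposition (fun s => L s * mellin φ s) σ₀ (poleOrder L 1) c G) {b : ℝ}
    (hb : 1 < b) : MemLp (fun x : ℝ => expPsi a L φ x * exp (-(b * x : ℂ))) 2 := by
  simp_rw [expPsi_eq hL h, sub_mul]
  exact (memLp_polarTerm _ _ hb).sub (memLp_expSum hL.coeff_isBigO hφ hL.lt_one hb)

/-- The residue term contributes exactly the principal part of L φ̂, so only the holomorphic part
survives the subtraction. -/
theorem laplace_expPsi (hL : IsContinuedDirichletSeries a σ₀ L) (hφ : IsAuxiliary φ σ₀)
    (h : IsPolarDecomposition (fun s => L s * mellin φ s) σ₀ (poleOrder L 1) c G) {s : ℂ}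
    (hs : 1 < s.re) : laplace (expPsi a L φ) s = -G s := by
  have h1 := laplace_polarTerm (poleOrder L 1) c hs
  have h2 := laplace_expSum hL.coeff_isBigO hφ hL.lt_one hs
  have hne : s ≠ 1 := by
    rintro rfl
    simp at hs
  have h3 := h.eq_add s (hL.lt_one.trans hs) (Or.inr hne)
  rw [laplace] at h1 h2 ⊢
  simp_rw [expPsi_eq hL h, sub_mul]
  rw [integral_sub (integrable_polarTerm _ _ hs)
    (integrable_expSum hL.coeff_isBigO hφ hL.lt_one hs), h1, h2, ← hL.eq_LSeries s hs, h3]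
  ring

theorem integrableOn_Ioi_one_iff {f : ℝ → ℂ} :
    IntegrableOn f (Ioi 1) ↔ IntegrableOn (fun x => Real.exp x • f (Real.exp x)) (Ioi 0) := by
  have himg : Real.exp '' Ioi 0 = Ioi 1 := by
    ext y
    constructor
    · rintro ⟨x, hx, rfl⟩
      exact Real.one_lt_exp_iff.2 hx
    · exact fun hy => ⟨Real.log y, Real.log_pos hy, Real.exp_log (one_pos.trans hy)⟩
  rw [← himg, integrableOn_image_iff_integrableOn_abs_deriv_smul (f' := Real.exp) measurableSet_Ioi
    (fun x _ => (Real.hasDerivAt_exp x).hasDerivWithinAt) Real.exp_injective.injOn]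
  simp only [Real.abs_exp]

theorem aestronglyMeasurable_psi (hL : IsContinuedDirichletSeries a σ₀ L) (hφ : IsAuxiliary φ σ₀)
    (h : IsPolarDecomposition (fun s => L s * mellin φ s) σ₀ (poleOrder L 1) c G) :
    AEStronglyMeasurable (psi a L φ) (volume.restrict (Ioi 1)) := by
  have h2 := (integrable_expPsi hL hφ h (s := ((2 : ℝ) : ℂ)) (by norm_num)).integrableOn (s := Ioi 0)
  -- Measurability of ψ is read off from integrability at s = 2: the power u⁻³ combines with du =
  -- exp x dx to give exp(-2x).
  have h3 : IntegrableOn (fun u : ℝ => psi a L φ u * (u : ℂ)⁻¹ ^ 3) (Ioi 1) := by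
    rw [integrableOn_Ioi_one_iff]
    refine h2.congr_fun (fun x hx => ?_) measurableSet_Ioi
    simp only
    rw [expPsi, indicator_of_mem hx, ofReal_exp, ← exp_neg, ← exp_nat_mul, real_smul, ofReal_exp,
      mul_left_comm, ← exp_add]
    congr 2
    push_cast
    ring
  have h4 : AEStronglyMeasurable (fun u : ℝ => (u : ℂ) ^ 3) (volume.restrict (Ioi 1)) :=
    (by fun_prop : Continuous fun u : ℝ => (u : ℂ) ^ 3).aestronglyMeasurable
  refine (h3.1.mul h4).congr ((ae_restrict_iff' measurableSet_Ioi).2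
    (Eventually.of_forall fun u hu => ?_))
  have hu' : (u : ℂ) ≠ 0 := by
    exact_mod_cast (one_pos.trans (show 1 < u from hu)).ne'
  simp only [Pi.mul_apply]
  field_simp

/-- With u = exp x, the weight u^(-1-2r) du becomes exp(-2r x) dx. -/
theorem memLp_psi_iff (hL : IsContinuedDirichletSeries a σ₀ L) (hφ : IsAuxiliary φ σ₀)
    (h : IsPolarDecomposition (fun s => L s * mellin φ s) σ₀ (poleOrder L 1) c G) (r : ℝ) :
    MemLp (psi a L φ) 2 (weightedMeasure r) ↔
      MemLp (fun x : ℝ => expPsi a L φ x * exp (-(r * x : ℂ))) 2 := by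
  have hms := aestronglyMeasurable_psi hL hφ h
  rw [memLp_two_iff_integrable_sq_norm (aestronglyMeasurable_laplace
      (integrable_expPsi hL hφ h (s := ((2 : ℝ) : ℂ)) (by norm_num)).1),
    weightedMeasure,
    memLp_two_iff_integrable_sq_norm (hms.mono_ac (withDensity_absolutelyContinuous _ _)),
    integrable_withDensity_iff (by fun_prop)
      (Eventually.of_forall fun _ => ENNReal.ofReal_lt_top)]
  have hC : ∀ {f : ℝ → ℝ} {μ : Measure ℝ}, Integrable f μ ↔ Integrable (fun x => (f x : ℂ)) μ :=
    fun {f μ} => ⟨fun h => h.ofReal, fun h => by simpa using! h.re⟩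
  rw [hC, ← IntegrableOn, integrableOn_Ioi_one_iff]
  have hind : (fun x : ℝ => ‖expPsi a L φ x * exp (-(r * x : ℂ))‖ ^ 2) = (Ioi 0).indicator
      fun x : ℝ => ‖psi a L φ (Real.exp x) * exp (-(r * x : ℂ))‖ ^ 2 := by
    ext x
    by_cases hx : x ∈ Ioi (0 : ℝ)
    · simp only [expPsi, indicator_of_mem hx]
    · simp only [expPsi, indicator_of_notMem hx, zero_mul, norm_zero]
      norm_num
  rw [hind, integrable_indicator_iff measurableSet_Ioi, IntegrableOn, IntegrableOn, hC (μ := _)]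
  refine iff_of_eq (congrArg (fun u => Integrable u _) (funext fun x => ?_))
  rw [ENNReal.toReal_ofReal (by positivity), real_smul, ← ofReal_mul]
  congr 1
  rw [norm_mul_exp_neg, mul_pow, mul_left_comm, ← Real.exp_nat_mul, ← Real.exp_mul, one_div,
    ← Real.exp_neg, ← Real.exp_add]
  congr 2
  simp
  ring

theorem memLp_inv_pow {r : ℝ} (hr : r ≠ 1) (j : ℕ) :
    MemLp (fun t : ℝ => (1 : ℂ) / (r + t * I - 1) ^ (j + 1)) 2 := by
  have hre : ∀ t : ℝ, (r + t * I - 1 : ℂ).re = r - 1 := fun t => by simp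
  have hne : ∀ t : ℝ, (r + t * I - 1 : ℂ) ≠ 0 := fun t h0 => by
    have := hre t
    rw [h0, zero_re] at this
    exact hr (by linarith)
  have hcont : Continuous fun t : ℝ => (1 : ℂ) / (r + t * I - 1) ^ (j + 1) :=
    continuous_const.div (by fun_prop) fun t => pow_ne_zero _ (hne t)
  rw [memLp_two_iff_integrable_sq_norm hcont.aestronglyMeasurable]
  have hd : 0 < |r - 1| := abs_pos.2 (sub_ne_zero.2 hr)
  have hi : Integrable fun t : ℝ => (1 + t ^ 2)⁻¹ := integrable_inv_one_add_sq
  -- Of the j + 1 factors, j are bounded by 1 / |r - 1|. The last one, squared, is 1 / ((r - 1)² +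
  -- t²), comparable to 1 / (1 + t²).
  refine (hi.const_mul ((1 / |r - 1| ^ j) ^ 2 * (1 + 1 / (r - 1) ^ 2))).mono'
    (hcont.norm.pow 2).aestronglyMeasurable (Eventually.of_forall fun t => ?_)
  have h1 : |r - 1| ≤ ‖(r + t * I - 1 : ℂ)‖ := hre t ▸ abs_re_le_norm _
  have h2 : ‖(r + t * I - 1 : ℂ)‖ ^ 2 = (r - 1) ^ 2 + t ^ 2 := by
    rw [Complex.sq_norm, normSq_apply, hre]
    simp
    ring
  have hr2 : 0 < (r - 1) ^ 2 := by positivity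
  rw [norm_pow, norm_norm, pow_succ (r + t * I - 1 : ℂ) j, ← div_div, norm_div, norm_div, norm_one,
    norm_pow, div_pow, h2, mul_assoc]
  have h3 : ((r - 1) ^ 2 + t ^ 2)⁻¹ ≤ (1 + 1 / (r - 1) ^ 2) * (1 + t ^ 2)⁻¹ := by
    rw [← div_eq_mul_inv, le_div_iff₀ (by positivity), inv_mul_le_iff₀ (by positivity)]
    have h4 : ((r - 1) ^ 2 + t ^ 2) * (1 + 1 / (r - 1) ^ 2)
        = 1 + t ^ 2 + (r - 1) ^ 2 + t ^ 2 / (r - 1) ^ 2 := by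
      field_simp
      ring
    rw [h4]
    have : 0 ≤ t ^ 2 / (r - 1) ^ 2 := by positivity
    linarith
  rw [div_eq_mul_inv]
  gcongr

theorem memLp_mul_mellin_iff
    (h : IsPolarDecomposition (fun s => L s * mellin φ s) σ₀ (poleOrder L 1) c G) {r : ℝ}
    (hr : σ₀ < r) (hr1 : 1 ≤ poleOrder L 1 → r ≠ 1) :
    MemLp (fun t : ℝ => L (r + t * I) * mellin φ (r + t * I)) 2 volume ↔
      MemLp (fun t : ℝ => G (r + t * I)) 2 := by
  have hQ : MemLp (fun t : ℝ => ∑ j ∈ Finset.range (poleOrder L 1),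
      c j / (r + t * I - 1 : ℂ) ^ (j + 1)) 2 := by
    refine memLp_finsetSum _ fun j hj => ?_
    have := (memLp_inv_pow (hr1 (by rw [Finset.mem_range] at hj; omega)) j).const_mul (c j)
    simpa only [mul_one_div] using this
  have heq : ∀ t : ℝ, L (r + t * I) * mellin φ (r + t * I)
      = (∑ j ∈ Finset.range (poleOrder L 1), c j / (r + t * I - 1 : ℂ) ^ (j + 1))
        + G (r + t * I) := fun t => by
    refine h.eq_add (r + t * I) (by simpa [halfPlane] using hr) ?_
    rcases Nat.eq_zero_or_pos (poleOrder L 1) with h0 | hpos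
    · exact Or.inl h0
    · refine Or.inr fun h1 => hr1 hpos ?_
      have := congrArg re h1
      simpa using this
  simp_rw [heq]
  refine ⟨fun h => ?_, fun h => hQ.add h⟩
  have := h.sub hQ
  refine (memLp_congr_ae (Eventually.of_forall fun t => ?_)).1 this
  simp

end DirichletMellin

theorem mainTheorem3 (a : ℕ → ℂ) (σ₀ : ℝ) (L : ℂ → ℂ) (φ : ℝ → ℂ)
    (hL : DirichletMellin.IsContinuedDirichletSeries a σ₀ L)
    (hφ : DirichletMellin.IsAuxiliary φ σ₀)
    (r : ℝ) (hr : σ₀ < r) (hr1 : 1 ≤ DirichletMellin.poleOrder L 1 → r ≠ 1) :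
    MemLp (DirichletMellin.psi a L φ) 2 (DirichletMellin.weightedMeasure r) ↔
      MemLp (fun t : ℝ => L (r + t * I) * mellin φ (r + t * I)) 2 volume := by
  obtain ⟨c, G, h⟩ := DirichletMellin.exists_polarDecomposition hL hφ
  rw [DirichletMellin.memLp_psi_iff hL hφ h, DirichletMellin.memLp_mul_mellin_iff h hr hr1]
  exact ⟨DirichletMellin.memLp_boundary_of_memLp
      (fun x hx => DirichletMellin.expPsi_of_nonpos hx) h.differentiableOn hr
      (fun s hs => DirichletMellin.laplace_expPsi hL hφ h hs),
    DirichletMellin.memLp_of_memLp_boundary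
      (fun x hx => DirichletMellin.expPsi_of_nonpos hx) h.differentiableOn hr
      (fun s hs => DirichletMellin.laplace_expPsi hL hφ h hs)
      (fun b hb => DirichletMellin.integrable_expPsi hL hφ h (s := (b : ℂ)) hb)
      (fun b hb => DirichletMellin.memLp_expPsi hL hφ h hb)
      (fun b κ hκ => DirichletMellin.growthBound_of_polarDecomposition hL hφ h hr hκ)⟩
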